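/- \textbf{Setting.} There are $n$ tasks with $C$ options each. The state of task $t$ is a probability vector $\mathbf a_t\in[0,1]^C$ (a row vector); an agent who performs $t$ receives signal $c$ with probability $\mathbf a_t(c)$, and an agent with strategy $\mathbf S$ (a row-stochastic $C\times C$ matrix; truth-telling is the identity) who receives $c$ reports $c'$ with probability $\mathbf S(c,c')$. Agent $j$ is assigned a random set $T_j$ of tasks; given the states, agents are independent of each other, $T_j$ is independent of the signals and reports, and these are independent over tasks. Agent $j$'s reports form a 0-1 matrix $\mathbf R_j\in\{0,1\}^{n\times C}$ with zero rows outside $T_j$. The answer matrix of a set of agents is the sum of their $\mathbf R_j$ with each row divided by its sum ($0/0:=0$). \textbf{DMI-clustering.} For $\mathbf A\in\mathbb R^{N\times d}$, let $k$ be the rank of $[\mathbf A\ \mathbf 1]$, pick $k$ linearly independent columns, with index list $L$, forming $\tilde{\mathbf A}=[\mathbf A\ \mathbf 1]_{:,L}$, let $\mathbf C^*$ maximize $\det[\mathbf C^\top\tilde{\mathbf A}]$ over the $0$-$1$ matrices $\mathbf C\in\{0,1\}^{N\times k}$ with all row sums $1$ (hard clusterings), and let $\mathbf D^*=(\mathbf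 C^{*\top}\tilde{\mathbf A})^{-1}$. Clusterings are compared up to permutation of their columns. \textbf{K-DMI mechanism.} The extracted knowledge is the DMI-clustering of the answer matrix of all agents. Agent $i$ is paid as follows. Let $T_i$ be the set of tasks she performed and let $\mathbf A$ be the answer matrix of the other agents. Apply DMI-clustering to the rows of $\mathbf A$ of the tasks outside $T_i$ on which some other agent reported, obtaining $k$, $L$ and $\mathbf D^*$. For $t\in T_i$ let the $t$-th row of $\mathbf C^*_i$ be the one-hot vector of the largest entry of the $t$-th row of $[\mathbf A\ \mathbf 1]_{:,L}\mathbf D^*$, ties being broken by a fixed rule depending only on that row. Split $T_i$ (depending only on $T_i$) into disjoint $T^1,T^2$ of size at least $C$, and pay $\prod_{\ell=1,2}\det(\mathbf C_\ell^{*\top}\mathbf R_i^\ell)$, where $\mathbf C^*_\ell,\mathbf R_i^\ell$ are the restrictions of $\mathbf C_i^*,\mathbf R_i$ to $T^\ell$; the payment is $0$ if $|T_i|<2C$ or if $k\ne C$. \textbf{Theorem.} \begin{enumerate} \item (Dominantly truthful.) Let there be finitely many agents, let the task states be i.i.d. from an arbitrary distribution, and let $i$ be an agent whose assigned set has an arbitrary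 law, while every other agent $j$ is assigned each task independently with some probability $p_j\in[0,1]$ (so that, to agent $i$, the other agents' answers are i.i.d. over tasks). Then, for all strategies of all agents, the expected payment of $i$ is well defined and does not decrease when $i$'s strategy is replaced by truth-telling. This holds whichever solutions of DMI-clustering, fixed tie-breaking rule and splitting rule are used. \item (Invariance.) Let there be infinitely many agents $1,2,\dots$, fix the states $\mathbf a_t$, and let $\mathbf A_0$ be the matrix with rows $\mathbf a_t$. Let the sets $T_j$ be such that $\Pr[t\in T_j]=p_t>0$ does not depend on $j$. If $\bar{\mathbf S}=\lim_m\frac1m\sum_{i\le m}\mathbf S_i$ exists and is invertible, then almost surely the answer matrix $\mathbf A^{(m)}$ of the first $m$ agents tends to $\mathbf A_0\bar{\mathbf S}$; DMI-clustering of $\mathbf A_0\bar{\mathbf S}$ has the same number of clusters and, up to relabeling the clusters, the same solutions as DMI-clustering of $\mathbf A_0$, whichever columns are picked for either. If moreover $\mathbf A_0$ has rank $C$, then almost surely, for all sufficiently large $m$, DMI-clustering of $\mathbf A^{(m)}$ has $C$ clusters and each of its solutions is, up to relabeling, a solution of DMI-clustering of $\mathbf A_0$. \item (Reduction and quality.)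 Let $\mathbf A\in\mathbb R^{n\times C}$ have rows that are probability vectors, and let it have rank $C$. Then DMI-clustering of $\mathbf A$ has $k=C$ clusters, $\tilde{\mathbf A}=\mathbf A$ is an admissible choice of columns, and for every admissible choice the solutions are, up to relabeling, those of $\operatorname{argmax}_{\mathbf C}\det[\mathbf C^\top\mathbf A]$. For every row-stochastic $\mathbf M$, $\max_{\mathbf C}\det[\mathbf C^\top\mathbf A\mathbf M]\le\max_{\mathbf C}\det[\mathbf C^\top\mathbf A]$, the maxima being over hard clusterings. In the situation of part 2, with $\mathbf A_0$ of rank $C$ and $\bar{\mathbf S}$ existing but not necessarily invertible, almost surely $\max_{\mathbf C}\det[\mathbf C^\top\mathbf A^{(m)}]\to\max_{\mathbf C}\det[\mathbf C^\top\mathbf A_0\bar{\mathbf S}]\le\max_{\mathbf C}\det[\mathbf C^\top\mathbf A_0]$. \end{enumerate} -/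

import Mathlib

open MeasureTheory ProbabilityTheory Filter Topology

noncomputable section

/-! ### DMI-clustering -/

/-- The set of hard clusterings of the points indexed by `τ` into `k` clusters: the 0-1 matrices
all of whose rows sum to one. -/
def hardClusterings (τ : Type*) (k : ℕ) : Set (Matrix τ (Fin k) ℝ) :=
  {X | (∀ t c, X t c = 0 ∨ X t c = 1) ∧ ∀ t, ∑ c, X t c = 1}

/-- The hard clusterings `X` that maximize `det (Xᵀ B)`. -/
def detMaximizers {τ : Type*} [Fintype τ] {k : ℕ} (B : Matrix τ (Fin k) ℝ) :
    Set (Matrix τ (Fin k) ℝ) :=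
  {X | X ∈ hardClusterings τ k ∧
    ∀ Y ∈ hardClusterings τ k, (Y.transpose * B).det ≤ (X.transpose * B).det}

/-- The values `det (Xᵀ B)`, for `X` a hard clustering. -/
def detValues {τ : Type*} [Fintype τ] {k : ℕ} (B : Matrix τ (Fin k) ℝ) : Set ℝ :=
  (fun X : Matrix τ (Fin k) ℝ => (X.transpose * B).det) '' hardClusterings τ k

/-- `v = max_X det (Xᵀ B)`, over hard clusterings `X`. -/
def dmiValue {τ : Type*} [Fintype τ] {k : ℕ} (B : Matrix τ (Fin k) ℝ) : ℝ := sSup (detValues B)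

/-- The matrix `A` with a column of ones appended. -/
def addOnes {τ : Type*} {d : ℕ} (A : Matrix τ (Fin d) ℝ) : Matrix τ (Fin d ⊕ Unit) ℝ :=
  Matrix.fromCols A (fun _ _ => 1)

/-- The matrix made of the columns of `[A 1]` whose indices are listed by `L`. -/
def pickCols {τ : Type*} {d k : ℕ} (A : Matrix τ (Fin d) ℝ) (L : Fin k → Fin d ⊕ Unit) :
    Matrix τ (Fin k) ℝ :=
  (addOnes A).submatrix id L

/-- `L` lists `k` linearly independent columns of `[A 1]`, where `k` is the rank of `[A 1]`. -/
def IsColumnChoice {τ : Type*} {d : ℕ} (A : Matrix τ (Fin d) ℝ) (k : ℕ)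
    (L : Fin k → Fin d ⊕ Unit) : Prop :=
  k = (addOnes A).rank ∧ LinearIndependent ℝ (pickCols A L).transpose

/-- What DMI-clustering returns: the number `k` of clusters, the list `L` of picked columns, and
the clustering `X`. The matrix `D` is computed from these and the data. -/
structure DMIOutput (τ : Type*) (d : ℕ) where
  k : ℕ
  L : Fin k → Fin d ⊕ Unit
  X : Matrix τ (Fin k) ℝ

/-- `o` is a possible output of DMI-clustering on the rows of `A`. -/
def IsDMIOutput {τ : Type*} [Fintype τ] {d : ℕ} (A : Matrix τ (Fin d) ℝ) (o : DMIOutput τ d) :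
    Prop :=
  IsColumnChoice A o.k o.L ∧ o.X ∈ detMaximizers (pickCols A o.L)

/-- The partition matrix `D = (Xᵀ Ã)⁻¹` returned by DMI-clustering. -/
def DMIOutput.D {τ : Type*} [Fintype τ] {d : ℕ} (A : Matrix τ (Fin d) ℝ) (o : DMIOutput τ d) :
    Matrix (Fin o.k) (Fin o.k) ℝ :=
  (o.X.transpose * pickCols A o.L)⁻¹

/-- The clusterings that belong to `F` after a permutation of the cluster labels. -/
def upToRelabeling {τ : Type*} {k : ℕ} (F : Set (Matrix τ (Fin k) ℝ)) :
    Set (Matrix τ (Fin k) ℝ) :=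
  {X | ∃ σ : Equiv.Perm (Fin k), X.submatrix id σ ∈ F}

/-- DMI-clustering gives the same clusterings, up to relabeling the clusters, on `A` and on `B`,
whichever columns are picked for either of them. -/
def SameDMIClusterings {τ : Type*} [Fintype τ] {d : ℕ} (A B : Matrix τ (Fin d) ℝ) : Prop :=
  (addOnes A).rank = (addOnes B).rank ∧
  ∀ (k : ℕ) (L L' : Fin k → Fin d ⊕ Unit), IsColumnChoice A k L → IsColumnChoice B k L' →
    upToRelabeling (detMaximizers (pickCols A L)) = upToRelabeling (detMaximizers (pickCols B L'))

/-- Every clustering that DMI-clustering can return on `B` is, up to relabeling the clusters, one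
that it can return on `A`, whichever columns are picked for either of them. -/
def DMIClusteringsRefine {τ : Type*} [Fintype τ] {d : ℕ} (B A : Matrix τ (Fin d) ℝ) : Prop :=
  (addOnes B).rank = (addOnes A).rank ∧
  ∀ (k : ℕ) (L L' : Fin k → Fin d ⊕ Unit), IsColumnChoice B k L → IsColumnChoice A k L' →
    detMaximizers (pickCols B L) ⊆ upToRelabeling (detMaximizers (pickCols A L'))

/-! ### The mechanism: there are `n` tasks with `C` options each -/

/-- The reports of one agent; `none` marks a task that the agent does not perform. -/
abbrev Reports (n C : ℕ) : Type := Fin n → Option (Fin C)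

/-- The 0-1 report matrix of an agent. -/
def reportMatrix {n C : ℕ} (r : Reports n C) : Matrix (Fin n) (Fin C) ℝ :=
  fun t c => if r t = some c then 1 else 0

/-- The tasks that an agent performed. -/
def performed {n C : ℕ} (r : Reports n C) : Finset (Fin n) :=
  Finset.univ.filter fun t => r t ≠ none

/-- The numbers of reports of each option for each task, by the agents in `J`. -/
def countMatrix {ι : Type*} {n C : ℕ} (J : Finset ι) (r : ι → Reports n C) :
    Matrix (Fin n) (Fin C) ℝ :=
  ∑ j ∈ J, reportMatrix (r j)

/-- The answer matrix of the agents in `J`: each row of the count matrix is divided by its sum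
(a task without any report gets the zero row). -/
def answerMatrix {ι : Type*} {n C : ℕ} (J : Finset ι) (r : ι → Reports n C) :
    Matrix (Fin n) (Fin C) ℝ :=
  fun t c => countMatrix J r t c / ∑ c', countMatrix J r t c'

/-- The rows of `M` indexed by `T`. -/
def rowsOf {τ κ : Type*} (T : Finset τ) (M : Matrix τ κ ℝ) : Matrix T κ ℝ :=
  M.submatrix (fun t => (t : τ)) id

/-- `e` is the one-hot vector of the index of a largest entry of `v`. -/
def IsIdxMax {k : ℕ} (v e : Fin k → ℝ) : Prop :=
  ∃ c, (∀ c', v c' ≤ v c) ∧ e = Pi.single c 1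

/-- The determinant of a `k × C` matrix, set to `0` when the matrix is not square. -/
def sqDet {k C : ℕ} (M : Matrix (Fin k) (Fin C) ℝ) : ℝ :=
  if h : k = C then (M.submatrix (Fin.cast h.symm) id).det else 0

/-- The choices that the mechanism leaves open: which solution DMI-clustering returns, how ties
in a row are broken (a fixed function of the row), and how the tasks that an agent performed are
divided into two parts. -/
structure KDMIChoices (n C : ℕ) where
  solver : ∀ U : Finset (Fin n), Matrix U (Fin C) ℝ → DMIOutput U C
  solver_spec : ∀ U A, IsDMIOutput A (solver U A)
  tie : ∀ k : ℕ, (Fin k → ℝ) → Fin k → ℝ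
  tie_spec : ∀ k v, 0 < k → IsIdxMax v (tie k v)
  part₁ : Finset (Fin n) → Finset (Fin n)
  part₂ : Finset (Fin n) → Finset (Fin n)
  part_disjoint : ∀ T, Disjoint (part₁ T) (part₂ T)
  part_union : ∀ T, part₁ T ∪ part₂ T = T
  part_card : ∀ T : Finset (Fin n), 2 * C ≤ T.card → C ≤ (part₁ T).card ∧ C ≤ (part₂ T).card

section Payment

variable {ι : Type*} [Fintype ι] [DecidableEq ι] {n C : ℕ}

/-- The tasks from which the partition for agent `i` is learned: those that she did not perform
and for which some other agent made a report. -/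
def learningTasks (r : ι → Reports n C) (i : ι) : Finset (Fin n) :=
  Finset.univ.filter fun t => r i t = none ∧ ∃ j, j ≠ i ∧ r j t ≠ none

/-- The output of DMI-clustering on the tasks from which the partition for agent `i` is learned,
with the answers of the other agents. -/
def learned (ch : KDMIChoices n C) (r : ι → Reports n C) (i : ι) :
    DMIOutput (learningTasks r i) C :=
  ch.solver (learningTasks r i)
    (rowsOf (learningTasks r i) (answerMatrix (Finset.univ.erase i) r))

/-- The clustering that the learned partition induces through the answers of the agents other
than `i`: row `t` is the one-hot vector of the largest entry of row `t` of `A_L D`. It is used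
for the tasks that agent `i` performed. -/
def inducedClusters (ch : KDMIChoices n C) (r : ι → Reports n C) (i : ι) :
    Matrix (Fin n) (Fin (learned ch r i).k) ℝ :=
  fun t => ch.tie _ ((pickCols (answerMatrix (Finset.univ.erase i) r) (learned ch r i).L *
    (learned ch r i).D (rowsOf (learningTasks r i) (answerMatrix (Finset.univ.erase i) r))) t)

/-- The payment of agent `i`; an agent who performed fewer than `2C` tasks is not paid. -/
def payment (ch : KDMIChoices n C) (r : ι → Reports n C) (i : ι) : ℝ :=
  if 2 * C ≤ (performed (r i)).card then
    sqDet ((rowsOf (ch.part₁ (performed (r i))) (inducedClusters ch r i)).transpose *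
      rowsOf (ch.part₁ (performed (r i))) (reportMatrix (r i))) *
    sqDet ((rowsOf (ch.part₂ (performed (r i))) (inducedClusters ch r i)).transpose *
      rowsOf (ch.part₂ (performed (r i))) (reportMatrix (r i)))
  else 0

end Payment

/-! ### The probabilistic model -/

/-- A task state: the distribution of the signal that an agent receives for the task. -/
abbrev TaskState (C : ℕ) : Type := stdSimplex ℝ (Fin C)

/-- A strategy: `S c c'` is the probability that an agent who receives `c` reports `c'`. The
truthful strategy is the identity matrix `1`. -/
abbrev Strategy (C : ℕ) : Type := Matrix.rowStochastic ℝ (Fin C)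

/-- A point of the simplex as a probability mass function. -/
def simplexPMF {C : ℕ} (x : stdSimplex ℝ (Fin C)) : PMF (Fin C) :=
  PMF.ofFintype (fun c => ENNReal.ofReal (x.1 c)) (by
    rw [← ENNReal.ofReal_sum_of_nonneg (fun c _ => x.2.1 c), x.2.2, ENNReal.ofReal_one])

/-- The row `c` of a strategy, as a point of the simplex. -/
def Strategy.row {C : ℕ} (S : Strategy C) (c : Fin C) : stdSimplex ℝ (Fin C) :=
  ⟨S.1 c, fun _ => Matrix.nonneg_of_mem_rowStochastic S.2,
    Matrix.sum_row_of_mem_rowStochastic S.2 c⟩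

/-- The law of the pair (signal received, option reported) on a task in state `a`. -/
def signalReportPMF {C : ℕ} (a : TaskState C) (S : Strategy C) : PMF (Fin C × Fin C) :=
  (simplexPMF a).bind fun c => (simplexPMF (S.row c)).map fun c' => (c, c')

/-- The randomness of one agent: the set of tasks that she is assigned, and for each task the
signal she receives and the option she reports if she is assigned the task. -/
abbrev AgentSample (n C : ℕ) : Type := Set (Fin n) × (Fin n → Fin C × Fin C)

/-- The law of the randomness of one agent, given the states `a` of the tasks: the assigned set
is drawn from `ρ`, independently of the signals and reports, which are independent over tasks. -/
def agentLaw {n C : ℕ} (ρ : ProbabilityMeasure (Set (Fin n))) (S : Strategy C)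
    (a : Fin n → TaskState C) : Measure (AgentSample n C) :=
  (ρ : Measure (Set (Fin n))).prod (Measure.pi fun t => (signalReportPMF (a t) S).toMeasure)

instance {n C : ℕ} (ρ : ProbabilityMeasure (Set (Fin n))) (S : Strategy C)
    (a : Fin n → TaskState C) : IsProbabilityMeasure (agentLaw ρ S a) := by
  unfold agentLaw; infer_instance

/-- The joint law of the randomness of all agents, who are independent given the states. -/
def agentsLaw {ι : Type*} {n C : ℕ} (ρ : ι → ProbabilityMeasure (Set (Fin n)))
    (S : ι → Strategy C) (a : Fin n → TaskState C) : Measure (ι → AgentSample n C) :=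
  Measure.infinitePi fun j => agentLaw (ρ j) (S j) a

open Classical in
/-- The reports that an agent makes. -/
def reportsOf {n C : ℕ} (w : AgentSample n C) : Reports n C :=
  fun t => if t ∈ w.1 then some (w.2 t).2 else none

/-- The expected payment of agent `i` given the states of the tasks. -/
def expectedPaymentGiven {ι : Type*} [Fintype ι] [DecidableEq ι] {n C : ℕ}
    (ch : KDMIChoices n C) (ρ : ι → ProbabilityMeasure (Set (Fin n))) (S : ι → Strategy C)
    (i : ι) (a : Fin n → TaskState C) : ℝ :=
  ∫ w, payment ch (fun j => reportsOf (w j)) i ∂(agentsLaw ρ S a)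

/-- The expected payment of agent `i` when the states of the tasks are drawn independently
from `μ`. -/
def expectedPayment {ι : Type*} [Fintype ι] [DecidableEq ι] {n C : ℕ}
    (ch : KDMIChoices n C) (μ : ProbabilityMeasure (TaskState C))
    (ρ : ι → ProbabilityMeasure (Set (Fin n))) (S : ι → Strategy C) (i : ι) : ℝ :=
  ∫ a, expectedPaymentGiven ch ρ S i a ∂(Measure.pi fun _ : Fin n => (μ : Measure (TaskState C)))

/-- The matrix whose row `t` is the state of task `t`, i.e. the distribution of honest answers. -/
def stateMatrix {n C : ℕ} (a : Fin n → TaskState C) : Matrix (Fin n) (Fin C) ℝ :=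
  fun t c => (a t).1 c

/-- The answer matrix of the first `m` agents. -/
def answersOfFirst {n C : ℕ} (w : ℕ → AgentSample n C) (m : ℕ) : Matrix (Fin n) (Fin C) ℝ :=
  answerMatrix (Finset.range m) fun j => reportsOf (w j)

/-- The average strategy of the first `m` agents tends to `M`. -/
def HasLimitingStrategy {C : ℕ} (S : ℕ → Strategy C) (M : Matrix (Fin C) (Fin C) ℝ) : Prop :=
  Tendsto (fun m : ℕ => (m : ℝ)⁻¹ • ∑ j ∈ Finset.range m, (S j : Matrix (Fin C) (Fin C) ℝ))
    atTop (𝓝 M)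

end

/-! ### Determinants over hard clusterings -/

section Clusterings

variable {τ : Type*} {k : ℕ}

/-! Truthfulness. Fix the set `T` performed by agent `i` and all reports outside `T`. The learned
clustering rule is then fixed, while the lists of reports on the tasks of `T` remain independent
with a common law. Expand the two determinants of the payment: since the two parts of `T` are
disjoint, each term involves `2C` distinct tasks, so the expectation is a nonnegative constant times
`det U ^ 2`, where `U` is the expected cluster-by-report matrix of a single task
(`exists_sum_prod_mul_det_mul_det`). The rule never sees the reports of `i`, hence a strategy `S`
replaces the truthful `U` by `U * S` (`IsGarbling.sum_mul_eq`) and costs a factor `det S ^ 2 ≤ 1`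
(`abs_det_le_one_of_mem_rowStochastic`). Two parts are needed because the sign of a single `det U`
is not controlled.

Invariance. If `Q = P * G` with `G` invertible, all objectives `det (Xᵀ P)` are multiplied by `det
G`; a negative sign is absorbed by an odd relabeling of the clusters. So only the column space
matters (`upToRelabeling_detMaximizers_congr`), and neither the choice of columns nor an invertible
average strategy changes it. Answer matrices converge by a strong law for independent bounded
variables with different laws; as there are finitely many hard clusterings, maximizers close to the
limit are maximizers of the limit (`eventually_detMaximizers_subset`).

Quality. `|det M| ≤ 1` again, together with the continuity of a maximum of finitely many
determinants. -/

theorem submatrix_mem_hardClusterings {X : Matrix τ (Fin k) ℝ} (hX : X ∈ hardClusterings τ k)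
    (σ : Equiv.Perm (Fin k)) : X.submatrix id σ ∈ hardClusterings τ k :=
  ⟨fun t c => hX.1 t (σ c), fun t => (Equiv.sum_comp σ (X t)).trans (hX.2 t)⟩

theorem hardClusterings_eq_of_card_le_one (hk : k ≤ 1) {X Y : Matrix τ (Fin k) ℝ}
    (hX : X ∈ hardClusterings τ k) (hY : Y ∈ hardClusterings τ k) : X = Y := by
  ext t c
  have h := (hX.2 t).trans (hY.2 t).symm
  have : Subsingleton (Fin k) := Fin.subsingleton_iff_le_one.2 hk
  rwa [Fintype.sum_subsingleton _ c, Fintype.sum_subsingleton _ c] at h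

theorem exists_sign_neg_one (hk : 2 ≤ k) : ∃ σ : Equiv.Perm (Fin k), Equiv.Perm.sign σ = -1 :=
  ⟨Equiv.swap ⟨0, by omega⟩ ⟨1, by omega⟩, Equiv.Perm.sign_swap (by simp)⟩

theorem subset_upToRelabeling (F : Set (Matrix τ (Fin k) ℝ)) : F ⊆ upToRelabeling F :=
  fun _ hX => ⟨1, hX⟩

theorem upToRelabeling_subset {F F' : Set (Matrix τ (Fin k) ℝ)} (h : F ⊆ upToRelabeling F') :
    upToRelabeling F ⊆ upToRelabeling F' := by
  rintro X ⟨σ, hσ⟩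
  obtain ⟨ρ, hρ⟩ := h hσ
  exact ⟨ρ.trans σ, hρ⟩

/-- The columns of `G` are coordinates of the columns of `Q` in those of `P`; a kernel vector of `G`
would be a linear relation among the columns of `Q`. -/
theorem exists_det_ne_zero_of_span_le {P Q : Matrix τ (Fin k) ℝ}
    (hQ : LinearIndependent ℝ Q.transpose)
    (h : Submodule.span ℝ (Set.range Q.transpose) ≤ Submodule.span ℝ (Set.range P.transpose)) :
    ∃ G : Matrix (Fin k) (Fin k) ℝ, G.det ≠ 0 ∧ Q = P * G := by
  have hmem : ∀ j, ∃ g : Fin k → ℝ, ∑ i, g i • P.transpose i = Q.transpose j := fun j =>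
    (Submodule.mem_span_range_iff_exists_fun ℝ).1 (h (Submodule.subset_span ⟨j, rfl⟩))
  choose g hg using hmem
  have hQP : Q = P * Matrix.of fun i j => g j i := by
    ext t j
    have := congrFun (hg j) t
    simp only [Finset.sum_apply, Pi.smul_apply, smul_eq_mul, Matrix.transpose_apply] at this
    simp only [Matrix.mul_apply, Matrix.of_apply, ← this, mul_comm]
  refine ⟨_, fun h0 => ?_, hQP⟩
  obtain ⟨v, hv, hGv⟩ := Matrix.exists_mulVec_eq_zero_iff.2 h0
  refine hv (funext fun j => Fintype.linearIndependent_iff.1 hQ v ?_ j)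
  have : Q.mulVec v = 0 := by rw [hQP, ← Matrix.mulVec_mulVec, hGv, Matrix.mulVec_zero]
  rw [← this]
  ext t
  simp [Matrix.mulVec, dotProduct, mul_comm]

variable [Fintype τ]

theorem det_relabel (X B : Matrix τ (Fin k) ℝ) (σ : Equiv.Perm (Fin k)) :
    ((X.submatrix id σ).transpose * B).det =
      (Equiv.Perm.sign σ : ℝ) * (X.transpose * B).det := by
  rw [← Matrix.det_permute]
  rfl

theorem det_transpose_mul_mul (X P : Matrix τ (Fin k) ℝ) (G : Matrix (Fin k) (Fin k) ℝ) :
    (X.transpose * (P * G)).det = (X.transpose * P).det * G.det := by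
  rw [← Matrix.mul_assoc, Matrix.det_mul]

/-- A positive `det G` preserves the order of the objectives. A negative one reverses it, and an odd
permutation of the labels reverses it back. -/
theorem detMaximizers_mul_subset (P : Matrix τ (Fin k) ℝ) {G : Matrix (Fin k) (Fin k) ℝ}
    (hG : G.det ≠ 0) : detMaximizers (P * G) ⊆ upToRelabeling (detMaximizers P) := by
  rintro X ⟨hX, hmax⟩
  simp only [det_transpose_mul_mul] at hmax
  rcases lt_or_gt_of_ne hG with hneg | hpos
  -- For `k ≤ 1` there is no odd permutation, but also at most one hard clustering.
  · rcases le_or_gt k 1 with hk | hk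
    · exact ⟨1, hX, fun Y hY => by
        rw [hardClusterings_eq_of_card_le_one hk hY hX]; rfl⟩
    · obtain ⟨σ, hσ⟩ := exists_sign_neg_one hk
      refine ⟨σ, submatrix_mem_hardClusterings hX σ, fun Y hY => ?_⟩
      have h := hmax _ (submatrix_mem_hardClusterings hY σ)
      rw [det_relabel, hσ] at h ⊢
      push_cast at h ⊢
      nlinarith
  · exact ⟨1, hX, fun Y hY => le_of_mul_le_mul_right (hmax Y hY) hpos⟩

theorem upToRelabeling_detMaximizers_mul (P : Matrix τ (Fin k) ℝ)
    {G : Matrix (Fin k) (Fin k) ℝ} (hG : G.det ≠ 0) :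
    upToRelabeling (detMaximizers (P * G)) = upToRelabeling (detMaximizers P) := by
  refine (upToRelabeling_subset (detMaximizers_mul_subset P hG)).antisymm
    (upToRelabeling_subset ?_)
  have h := detMaximizers_mul_subset (P * G) (G := G⁻¹)
    (Matrix.isUnit_nonsing_inv_det _ (isUnit_iff_ne_zero.2 hG)).ne_zero
  rwa [Matrix.mul_assoc, Matrix.mul_nonsing_inv _ (isUnit_iff_ne_zero.2 hG), Matrix.mul_one] at h

end Clusterings

/-! ### Column spaces -/

section Columns

variable {τ : Type*} {d k : ℕ}

/-- The column space of a matrix. -/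
def colSpan {κ : Type*} (A : Matrix τ κ ℝ) : Submodule ℝ (τ → ℝ) :=
  Submodule.span ℝ (Set.range A.transpose)

theorem rank_eq_finrank_colSpan {κ : Type*} [Fintype κ] (A : Matrix τ κ ℝ) :
    A.rank = Module.finrank ℝ (colSpan A) :=
  A.rank_eq_finrank_span_cols

theorem linearIndependent_transpose_iff_rank [Finite τ] (A : Matrix τ (Fin k) ℝ) :
    LinearIndependent ℝ A.transpose ↔ A.rank = k := by
  refine (linearIndependent_iff_card_eq_finrank_span (b := A.transpose)).trans ?_
  rw [rank_eq_finrank_colSpan, Fintype.card_fin, eq_comm]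
  rfl

/-- The column of ones is the sum of the columns of `A`. -/
theorem colSpan_addOnes {A : Matrix τ (Fin d) ℝ} (hA : ∀ t, ∑ c, A t c = 1) :
    colSpan (addOnes A) = colSpan A := by
  refine le_antisymm (Submodule.span_le.2 ?_) (Submodule.span_mono ?_)
  · rintro _ ⟨c | u, rfl⟩
    · exact Submodule.subset_span ⟨c, rfl⟩
    · have : (addOnes A).transpose (Sum.inr u) = ∑ c, A.transpose c := by
        ext t
        exact ((Finset.sum_apply t Finset.univ fun c t => A t c).trans (hA t)).symm
      rw [this]
      exact Submodule.sum_mem _ fun c _ => Submodule.subset_span ⟨c, rfl⟩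
  · rintro _ ⟨c, rfl⟩
    exact ⟨Sum.inl c, rfl⟩

theorem IsColumnChoice.colSpan_eq [Finite τ] {A : Matrix τ (Fin d) ℝ} {L : Fin k → Fin d ⊕ Unit}
    (h : IsColumnChoice A k L) : colSpan (pickCols A L) = colSpan (addOnes A) := by
  have : Fintype τ := Fintype.ofFinite τ
  refine Submodule.eq_of_le_of_finrank_eq (Submodule.span_mono ?_) ?_
  · rintro _ ⟨c, rfl⟩
    exact ⟨L c, rfl⟩
  · rw [← rank_eq_finrank_colSpan, ← rank_eq_finrank_colSpan, ← h.1]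
    exact (linearIndependent_transpose_iff_rank _).1 h.2

theorem colSpan_mul_of_isUnit {A : Matrix τ (Fin d) ℝ} {M : Matrix (Fin d) (Fin d) ℝ}
    (hM : IsUnit M) : colSpan (A * M) = colSpan A := by
  have hle : ∀ (A : Matrix τ (Fin d) ℝ) (M : Matrix (Fin d) (Fin d) ℝ),
      colSpan (A * M) ≤ colSpan A := fun A M => by
    refine Submodule.span_le.2 ?_
    rintro _ ⟨c, rfl⟩
    have : (A * M).transpose c = ∑ i, M i c • A.transpose i := by
      ext t
      simp [Matrix.mul_apply, mul_comm]
    rw [this]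
    exact Submodule.sum_mem _ fun i _ =>
      Submodule.smul_mem _ _ (Submodule.subset_span ⟨i, rfl⟩)
  refine (hle A M).antisymm ?_
  have h := hle (A * M) M⁻¹
  rwa [Matrix.mul_assoc, Matrix.mul_nonsing_inv _ ((Matrix.isUnit_iff_isUnit_det _).1 hM),
    Matrix.mul_one] at h

variable [Fintype τ]

/-- This covers both sources of ambiguity at once: different picks of columns for one matrix, and
different matrices with a common column space. -/
theorem upToRelabeling_detMaximizers_congr {P Q : Matrix τ (Fin k) ℝ}
    (hQ : LinearIndependent ℝ Q.transpose) (h : colSpan P = colSpan Q) :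
    upToRelabeling (detMaximizers P) = upToRelabeling (detMaximizers Q) := by
  obtain ⟨G, hG, rfl⟩ := exists_det_ne_zero_of_span_le hQ h.ge
  exact (upToRelabeling_detMaximizers_mul P hG).symm

theorem sameDMIClusterings_of_colSpan_eq {A B : Matrix τ (Fin d) ℝ}
    (h : colSpan (addOnes A) = colSpan (addOnes B)) : SameDMIClusterings A B :=
  ⟨by rw [rank_eq_finrank_colSpan, rank_eq_finrank_colSpan, h], fun _ _ _ hL hL' =>
    upToRelabeling_detMaximizers_congr hL'.2 (by rw [hL.colSpan_eq, hL'.colSpan_eq, h])⟩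

theorem isColumnChoice_inl {A : Matrix τ (Fin d) ℝ} (hA : ∀ t, ∑ c, A t c = 1)
    (hr : A.rank = d) : IsColumnChoice A d Sum.inl := by
  refine ⟨?_, (linearIndependent_transpose_iff_rank A).2 hr⟩
  rw [rank_eq_finrank_colSpan, colSpan_addOnes hA, ← rank_eq_finrank_colSpan, hr]

theorem upToRelabeling_detMaximizers_pickCols {A : Matrix τ (Fin d) ℝ}
    (hA : ∀ t, ∑ c, A t c = 1) (hr : A.rank = d) {L : Fin d → Fin d ⊕ Unit}
    (hL : IsColumnChoice A d L) :
    upToRelabeling (detMaximizers (pickCols A L)) = upToRelabeling (detMaximizers A) :=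
  upToRelabeling_detMaximizers_congr ((linearIndependent_transpose_iff_rank A).2 hr)
    (by rw [hL.colSpan_eq, colSpan_addOnes hA])

end Columns

/-! ### The maximum of the determinant -/

section Values

variable {τ : Type*} {k : ℕ}

theorem single_mem_hardClusterings (f : τ → Fin k) :
    (fun t => Pi.single (f t) 1 : Matrix τ (Fin k) ℝ) ∈ hardClusterings τ k := by
  refine ⟨fun t c => ?_, fun t => by simp⟩
  rcases eq_or_ne c (f t) with rfl | h
  · exact Or.inr (Pi.single_eq_same _ _)
  · exact Or.inl (Pi.single_eq_of_ne h _)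

/-- A row with sum one cannot be empty, so there is a label for every point; with no points at all
the empty clustering serves, even for `k = 0`. -/
theorem hardClusterings_nonempty {A : Matrix τ (Fin k) ℝ} (hA : ∀ t, ∑ c, A t c = 1) :
    (hardClusterings τ k).Nonempty := by
  have h : ∀ t, Nonempty (Fin k) := fun t => by
    by_contra hempty
    rw [not_nonempty_iff] at hempty
    simpa using hA t
  exact ⟨_, single_mem_hardClusterings fun t => (h t).some⟩

variable [Fintype τ]

variable (τ k) in
theorem finite_hardClusterings : (hardClusterings τ k).Finite := by
  refine (Set.Finite.pi' fun _ : τ => Set.Finite.pi' fun _ : Fin k =>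
    Set.toFinite ({0, 1} : Set ℝ)).subset fun X hX t c => ?_
  simpa using hX.1 t c

theorem finite_detValues (B : Matrix τ (Fin k) ℝ) : (detValues B).Finite :=
  (finite_hardClusterings τ k).image _

theorem le_dmiValue (B : Matrix τ (Fin k) ℝ) {X : Matrix τ (Fin k) ℝ}
    (hX : X ∈ hardClusterings τ k) : (X.transpose * B).det ≤ dmiValue B :=
  le_csSup (finite_detValues B).bddAbove ⟨X, hX, rfl⟩

theorem isGreatest_dmiValue (B : Matrix τ (Fin k) ℝ) (h : (hardClusterings τ k).Nonempty) :
    IsGreatest (detValues B) (dmiValue B) :=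
  ⟨(h.image _).csSup_mem (finite_detValues B),
    fun _ hv => le_csSup (finite_detValues B).bddAbove hv⟩

theorem continuous_det_transpose_mul (X : Matrix τ (Fin k) ℝ) :
    Continuous fun B : Matrix τ (Fin k) ℝ => (X.transpose * B).det :=
  (continuous_const.matrix_mul continuous_id).matrix_det

theorem continuous_dmiValue : Continuous (dmiValue : Matrix τ (Fin k) ℝ → ℝ) := by
  rcases (hardClusterings τ k).eq_empty_or_nonempty with h | h
  -- Without hard clusterings the value is the default `sSup ∅ = 0`.
  · have : (dmiValue : Matrix τ (Fin k) ℝ → ℝ) = fun _ => 0 := by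
      funext B
      simp [dmiValue, detValues, h]
    rw [this]
    exact continuous_const
  · have hne : (finite_hardClusterings τ k).toFinset.Nonempty := by simpa using h
    have : (dmiValue : Matrix τ (Fin k) ℝ → ℝ) = fun B =>
        (finite_hardClusterings τ k).toFinset.sup' hne fun X => (X.transpose * B).det := by
      funext B
      rw [Finset.sup'_eq_csSup_image, Set.Finite.coe_toFinset]
      rfl
    rw [this]
    exact Continuous.finset_sup'_apply hne fun X _ => continuous_det_transpose_mul X

/-- A clustering that is not optimal for `B₀` is strictly beaten there, and the strict inequality
persists nearby; finitely many clusterings make this uniform. Ties at `B₀` may be broken along the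
way, hence only an inclusion. -/
theorem eventually_detMaximizers_subset {α : Type*} {l : Filter α}
    {B : α → Matrix τ (Fin k) ℝ} {B₀ : Matrix τ (Fin k) ℝ} (h : Tendsto B l (𝓝 B₀)) :
    ∀ᶠ m in l, detMaximizers (B m) ⊆ detMaximizers B₀ := by
  have hdet : ∀ X : Matrix τ (Fin k) ℝ,
      Tendsto (fun m => (X.transpose * B m).det) l (𝓝 (X.transpose * B₀).det) := fun X =>
    ((continuous_det_transpose_mul X).tendsto B₀).comp h
  have key : ∀ X ∈ hardClusterings τ k, ∀ᶠ m in l, X ∈ detMaximizers (B m) →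
      X ∈ detMaximizers B₀ := by
    intro X hX
    by_cases hX₀ : X ∈ detMaximizers B₀
    · exact Eventually.of_forall fun _ _ => hX₀
    · have : ∃ Y ∈ hardClusterings τ k, (X.transpose * B₀).det < (Y.transpose * B₀).det := by
        by_contra! hcon
        exact hX₀ ⟨hX, hcon⟩
      obtain ⟨Y, hY, hlt⟩ := this
      filter_upwards [(hdet X).eventually_lt (hdet Y) hlt] with m hm hXm
      exact absurd (hXm.2 Y hY) (not_le.2 hm)
  filter_upwards [(eventually_all_finite (finite_hardClusterings τ k)).2 key] with m hm X hX
  exact hm X hX.1 hX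

end Values

/-! ### Row-stochastic matrices -/

/-- Drop the signs in the Leibniz formula and enlarge the sum from permutations to all maps: the
result is the product of the row sums. -/
theorem abs_det_le_one_of_mem_rowStochastic {ι : Type*} [Fintype ι] [DecidableEq ι]
    {M : Matrix ι ι ℝ} (hM : M ∈ Matrix.rowStochastic ℝ ι) : |M.det| ≤ 1 := by
  have h0 : ∀ i j, 0 ≤ M i j := fun i j => Matrix.nonneg_of_mem_rowStochastic hM
  -- Transposing makes each product take one factor from every row `i`, so that the row sums appear.
  rw [← Matrix.det_transpose, Matrix.det_apply]
  calc |∑ σ : Equiv.Perm ι, Equiv.Perm.sign σ • ∏ i, M.transpose (σ i) i|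
      ≤ ∑ σ : Equiv.Perm ι, |Equiv.Perm.sign σ • ∏ i, M.transpose (σ i) i| :=
        Finset.abs_sum_le_sum_abs _ _
    _ = ∑ σ : Equiv.Perm ι, ∏ i, M i (σ i) := by
        refine Finset.sum_congr rfl fun σ _ => ?_
        have hp : 0 ≤ ∏ i, M.transpose (σ i) i := Finset.prod_nonneg fun i _ => h0 _ _
        rcases Int.units_eq_one_or (Equiv.Perm.sign σ) with h | h <;>
          simp only [h, one_smul, Units.neg_smul, abs_neg, abs_of_nonneg hp] <;> rfl
    _ ≤ ∑ f : ι → ι, ∏ i, M i (f i) := by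
        refine (Finset.sum_map Finset.univ
          ⟨fun σ : Equiv.Perm ι => (σ : ι → ι), DFunLike.coe_injective⟩
          fun f : ι → ι => ∏ i, M i (f i)).symm.trans_le ?_
        exact Finset.sum_le_sum_of_subset_of_nonneg (Finset.subset_univ _)
          fun f _ _ => Finset.prod_nonneg fun i _ => h0 _ _
    _ = 1 := by
        refine (Fintype.prod_sum fun i j => M i j).symm.trans ?_
        exact Finset.prod_eq_one fun i _ => Matrix.sum_row_of_mem_rowStochastic hM i

theorem sum_mul_rowStochastic {τ : Type*} {C : ℕ} {A : Matrix τ (Fin C) ℝ}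
    (hA : ∀ t, ∑ c, A t c = 1) {M : Matrix (Fin C) (Fin C) ℝ}
    (hM : M ∈ Matrix.rowStochastic ℝ (Fin C)) (t : τ) : ∑ c, (A * M) t c = 1 := by
  simp only [Matrix.mul_apply]
  rw [Finset.sum_comm, ← hA t]
  refine Finset.sum_congr rfl fun c _ => ?_
  rw [← Finset.mul_sum, Matrix.sum_row_of_mem_rowStochastic hM, mul_one]

/-- Since `det M` may be negative, `|det (Xᵀ A)|` has to be bounded by the maximum; an odd
relabeling of `X` does this. -/
theorem dmiValue_mul_le {τ : Type*} [Fintype τ] {C : ℕ} (A : Matrix τ (Fin C) ℝ)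
    {M : Matrix (Fin C) (Fin C) ℝ} (hM : M ∈ Matrix.rowStochastic ℝ (Fin C)) :
    dmiValue (A * M) ≤ dmiValue A := by
  -- No odd relabeling exists here, but the only row-stochastic matrix is the identity.
  rcases le_or_gt C 1 with hC | hC
  · have : Subsingleton (Fin C) := Fin.subsingleton_iff_le_one.2 hC
    have : M = 1 := by
      ext i j
      have h := Matrix.sum_row_of_mem_rowStochastic hM i
      rw [Fintype.sum_subsingleton _ j] at h
      rw [h, Subsingleton.elim j i, Matrix.one_apply_eq]
    rw [this, Matrix.mul_one]
  rcases (hardClusterings τ C).eq_empty_or_nonempty with h | h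
  · simp [dmiValue, detValues, h]
  refine csSup_le (h.image _) ?_
  rintro _ ⟨X, hX, rfl⟩
  change (X.transpose * (A * M)).det ≤ _
  rw [det_transpose_mul_mul]
  have habs : |(X.transpose * A).det| ≤ dmiValue A := by
    obtain ⟨σ, hσ⟩ := exists_sign_neg_one hC
    refine abs_le'.2 ⟨le_dmiValue A hX, ?_⟩
    have := le_dmiValue A (submatrix_mem_hardClusterings hX σ)
    rw [det_relabel, hσ] at this
    simpa using this
  calc (X.transpose * A).det * M.det ≤ |(X.transpose * A).det * M.det| := le_abs_self _
    _ = |(X.transpose * A).det| * |M.det| := abs_mul _ _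
    _ ≤ |(X.transpose * A).det| :=
        mul_le_of_le_one_right (abs_nonneg _) (abs_det_le_one_of_mem_rowStochastic hM)
    _ ≤ dmiValue A := habs

/-! ### A strong law of large numbers for independent bounded variables -/

section StrongLaw

variable {Ω : Type*} [MeasurableSpace Ω] {P : Measure Ω} [IsProbabilityMeasure P]

/-- The Hoeffding bound for the tail event is geometric in `m`, so Borel–Cantelli applies. -/
theorem ae_eventually_sum_lt {X : ℕ → Ω → ℝ} (hind : iIndepFun X P) {c : NNReal} (hc : 0 < c)
    (hX : ∀ j, HasSubgaussianMGF (X j) c P) {ε : ℝ} (hε : 0 < ε) :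
    ∀ᵐ w ∂P, ∀ᶠ m : ℕ in atTop, ∑ j ∈ Finset.range m, X j w < ε * m := by
  have hbound : ∀ m : ℕ, P {w | ε * m ≤ ∑ j ∈ Finset.range m, X j w} ≤
      ENNReal.ofReal (Real.exp (-ε ^ 2 / (2 * c)) ^ m) := fun m => by
    have h := HasSubgaussianMGF.measure_sum_range_ge_le_of_iIndepFun hind (n := m)
      (fun i _ => hX i) (ε := ε * m) (by positivity)
    rw [← ofReal_measureReal]
    refine ENNReal.ofReal_le_ofReal (h.trans_eq ?_)
    rw [← Real.exp_nat_mul]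
    congr 1
    have : (c : ℝ) ≠ 0 := by exact_mod_cast hc.ne'
    rcases Nat.eq_zero_or_pos m with rfl | hm
    · simp
    · field_simp
  have hr : Real.exp (-ε ^ 2 / (2 * c)) < 1 := by
    have : (0 : ℝ) < c := hc
    rw [Real.exp_lt_one_iff]
    exact div_neg_of_neg_of_pos (by nlinarith) (by positivity)
  have hsum : ∑' m : ℕ, P {w | ε * m ≤ ∑ j ∈ Finset.range m, X j w} ≠ ⊤ :=
    ne_top_of_le_ne_top
      (summable_geometric_of_lt_one (Real.exp_pos _).le hr).tsum_ofReal_ne_top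
      (ENNReal.tsum_le_tsum hbound)
  filter_upwards [ae_eventually_notMem hsum] with w hw
  filter_upwards [hw] with m hm
  exact not_le.1 hm

/-- Agents may use different strategies, so the variables are not identically distributed and each
is centred at its own mean. The one-sided bound is applied to the variables and to their negatives,
for the countably many tolerances `1 / (q + 1)`. -/
theorem ae_tendsto_average_sub_integral {X : ℕ → Ω → ℝ} (hind : iIndepFun X P)
    (hm : ∀ j, Measurable (X j)) (hX : ∀ j w, X j w ∈ Set.Icc (0 : ℝ) 1) :
    ∀ᵐ w ∂P, Tendsto (fun m : ℕ => (m : ℝ)⁻¹ * ∑ j ∈ Finset.range m, (X j w - P[X j]))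
      atTop (𝓝 0) := by
  have hsub : ∀ j, HasSubgaussianMGF (fun w => X j w - P[X j]) ((‖(1 : ℝ) - 0‖₊ / 2) ^ 2) P :=
    fun j => hasSubgaussianMGF_of_mem_Icc (hm j).aemeasurable (Eventually.of_forall (hX j))
  have hc : (0 : NNReal) < (‖(1 : ℝ) - 0‖₊ / 2) ^ 2 := by simp
  have hind' : iIndepFun (fun j w => X j w - P[X j]) P :=
    hind.comp (fun j (x : ℝ) => x - ∫ w, X j w ∂P) fun j => measurable_id.sub_const _
  have hneg : iIndepFun (fun j w => -(X j w - P[X j])) P :=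
    hind'.comp (fun _ x => -x) fun _ => measurable_neg
  have h₁ : ∀ᵐ w ∂P, ∀ q : ℕ, ∀ᶠ m : ℕ in atTop,
      ∑ j ∈ Finset.range m, (X j w - P[X j]) < 1 / ((q : ℝ) + 1) * m :=
    ae_all_iff.2 fun q => ae_eventually_sum_lt hind' hc hsub Nat.one_div_pos_of_nat
  have h₂ : ∀ᵐ w ∂P, ∀ q : ℕ, ∀ᶠ m : ℕ in atTop,
      ∑ j ∈ Finset.range m, -(X j w - P[X j]) < 1 / ((q : ℝ) + 1) * m :=
    ae_all_iff.2 fun q => ae_eventually_sum_lt hneg hc (fun j => (hsub j).neg)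
      Nat.one_div_pos_of_nat
  filter_upwards [h₁, h₂] with w hw₁ hw₂
  -- The variant with strict `m > N` also yields `m > 0`, which is needed to clear `m⁻¹`.
  rw [Metric.tendsto_atTop']
  intro ε hε
  obtain ⟨q, hq⟩ := exists_nat_one_div_lt hε
  obtain ⟨N, hN⟩ := eventually_atTop.1 ((hw₁ q).and (hw₂ q))
  refine ⟨N, fun m hmN => ?_⟩
  obtain ⟨ha, hb⟩ := hN m hmN.le
  rw [Finset.sum_neg_distrib] at hb
  have hm0 : (0 : ℝ) < m := by exact_mod_cast (Nat.zero_le N).trans_lt hmN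
  rw [Real.dist_eq, sub_zero, abs_mul, abs_inv, abs_of_pos hm0, inv_mul_lt_iff₀ hm0]
  refine (abs_lt.2 ⟨by linarith, ha⟩).trans ?_
  rw [mul_comm]
  exact mul_lt_mul_of_pos_left hq hm0

end StrongLaw

/-! ### The law of the reports -/

section ReportLaw

variable {n C : ℕ}

/-- The probability that an agent with strategy `S` who performs a task in state `x`
reports `c`. -/
noncomputable def reportProb (x : TaskState C) (S : Matrix (Fin C) (Fin C) ℝ) (c : Fin C) : ℝ :=
  ∑ b, x.1 b * S b c

theorem reportProb_nonneg (x : TaskState C) (S : Strategy C) (c : Fin C) :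
    0 ≤ reportProb x S.1 c :=
  Finset.sum_nonneg fun b _ => mul_nonneg (x.2.1 b) (Matrix.nonneg_of_mem_rowStochastic S.2)

theorem measureReal_report_eq (x : TaskState C) (S : Strategy C) (c : Fin C) :
    (signalReportPMF x S).toMeasure.real {q | q.2 = c} = reportProb x S.1 c := by
  rw [measureReal_def, PMF.toMeasure_apply_fintype]
  have hval : ∀ q : Fin C × Fin C, signalReportPMF x S q =
      ENNReal.ofReal (x.1 q.1 * S.1 q.1 q.2) := by
    rintro ⟨b, b'⟩
    rw [signalReportPMF, PMF.bind_apply, tsum_fintype, Finset.sum_eq_single b]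
    · rw [PMF.map_apply, tsum_fintype, Finset.sum_eq_single b']
      · simp only [simplexPMF, PMF.ofFintype_apply, if_true, Strategy.row]
        exact (ENNReal.ofReal_mul (x.2.1 b)).symm
      · intro d _ hd
        simp [hd.symm]
      · simp
    · intro d _ hd
      rw [PMF.map_apply]
      simp [hd.symm]
    · simp
  have hnn : ∀ b, 0 ≤ x.1 b * S.1 b c := fun b =>
    mul_nonneg (x.2.1 b) (Matrix.nonneg_of_mem_rowStochastic S.2)
  have : ∑ q : Fin C × Fin C, ({q | q.2 = c} : Set (Fin C × Fin C)).indicator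
      (signalReportPMF x S) q = ENNReal.ofReal (reportProb x S.1 c) := by
    rw [reportProb, ENNReal.ofReal_sum_of_nonneg fun b _ => hnn b, Fintype.sum_prod_type]
    refine Finset.sum_congr rfl fun b _ => ?_
    rw [Finset.sum_eq_single c]
    · simp [hval]
    · intro d _ hd
      simp [hd]
    · simp
  rw [this, ENNReal.toReal_ofReal (reportProb_nonneg x S c)]

/-- The fibre is a box, so product measures can be evaluated on it factor by factor; tasks that are
not assigned impose no constraint on the signals. -/
theorem preimage_reportsOf (r : Reports n C) :
    reportsOf ⁻¹' {r} = ({{t | r t ≠ none}} : Set (Set (Fin n))) ×ˢ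
      Set.univ.pi fun t => {q : Fin C × Fin C | ∀ c, r t = some c → q.2 = c} := by
  ext w
  simp only [Set.mem_preimage, Set.mem_singleton_iff, Set.mem_prod, Set.mem_pi, Set.mem_univ,
    true_implies, Set.mem_ofPred_eq]
  constructor
  · rintro rfl
    refine ⟨?_, fun t c h => ?_⟩
    · ext t
      by_cases ht : t ∈ w.1 <;> simp [reportsOf, ht]
    · by_cases ht : t ∈ w.1 <;> simp_all [reportsOf]
  · rintro ⟨h₁, h₂⟩
    funext t
    cases hr : r t with
    | none => simp [reportsOf, h₁, hr]
    | some c => simp [reportsOf, h₁, hr, h₂ t c hr]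

/-- The probability of the report `o` given that the task is performed exactly if `o` is a
report. -/
noncomputable def reportFactor (x : TaskState C) (S : Matrix (Fin C) (Fin C) ℝ) :
    Option (Fin C) → ℝ
  | none => 1
  | some c => reportProb x S c

theorem agentLaw_real_preimage_reportsOf (ρ : ProbabilityMeasure (Set (Fin n))) (S : Strategy C)
    (a : Fin n → TaskState C) (r : Reports n C) :
    (agentLaw ρ S a).real (reportsOf ⁻¹' {r}) =
      (ρ : Measure (Set (Fin n))).real {{t | r t ≠ none}} *
        ∏ t, reportFactor (a t) S.1 (r t) := by
  rw [preimage_reportsOf, agentLaw, measureReal_prod_prod, Measure.real, Measure.real,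
    Measure.pi_pi, ENNReal.toReal_prod]
  congr 1
  refine Finset.prod_congr rfl fun t _ => ?_
  cases r t with
  | none => simp [reportFactor]
  | some c =>
    rw [reportFactor, ← measureReal_report_eq, Measure.real]
    congr 2
    ext q
    simp [eq_comm]

theorem agentLaw_real_report (ρ : ProbabilityMeasure (Set (Fin n))) (S : Strategy C)
    (a : Fin n → TaskState C) (t : Fin n) (c : Fin C) :
    (agentLaw ρ S a).real {w | reportsOf w t = some c} =
      (ρ : Measure (Set (Fin n))).real {T | t ∈ T} * reportProb (a t) S.1 c := by
  have : {w : AgentSample n C | reportsOf w t = some c} =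
      {T : Set (Fin n) | t ∈ T} ×ˢ (Function.eval t ⁻¹' {q : Fin C × Fin C | q.2 = c}) := by
    ext w
    by_cases ht : t ∈ w.1 <;> simp [reportsOf, ht]
  rw [this, agentLaw, measureReal_prod_prod, ← measureReal_report_eq]
  congr 1
  exact (measurePreserving_eval _ t).measureReal_preimage
    (Set.toFinite _).measurableSet.nullMeasurableSet

end ReportLaw

/-! ### Answer matrices of many agents -/

section Limits

variable {n C : ℕ}

theorem HasLimitingStrategy.mem_rowStochastic {S : ℕ → Strategy C}
    {M : Matrix (Fin C) (Fin C) ℝ} (h : HasLimitingStrategy S M) :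
    M ∈ Matrix.rowStochastic ℝ (Fin C) := by
  have hentry : ∀ b c, Tendsto (fun m : ℕ => (m : ℝ)⁻¹ * ∑ j ∈ Finset.range m, (S j).1 b c)
      atTop (𝓝 (M b c)) := fun b c => by
    refine (((continuous_id.matrix_elem b c).tendsto M).comp h).congr fun m => ?_
    simp [Matrix.sum_apply]
  rw [Matrix.mem_rowStochastic_iff_sum]
  refine ⟨fun b c => ge_of_tendsto' (hentry b c) fun m => ?_, fun b => ?_⟩
  · exact mul_nonneg (by positivity)
      (Finset.sum_nonneg fun j _ => Matrix.nonneg_of_mem_rowStochastic (S j).2)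
  · refine tendsto_nhds_unique (tendsto_finsetSum Finset.univ fun c _ => hentry b c) ?_
    refine tendsto_const_nhds.congr' ?_
    -- The average over zero agents is the zero matrix, so its row sums are not one.
    filter_upwards [eventually_gt_atTop 0] with m hm
    rw [← Finset.mul_sum, Finset.sum_comm,
      Finset.sum_congr rfl fun j _ => Matrix.sum_row_of_mem_rowStochastic (S j).2 b]
    have : (m : ℝ) ≠ 0 := by exact_mod_cast hm.ne'
    simp [this]

theorem HasLimitingStrategy.tendsto_reportProb {S : ℕ → Strategy C}
    {M : Matrix (Fin C) (Fin C) ℝ} (h : HasLimitingStrategy S M) (x : TaskState C) (c : Fin C) :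
    Tendsto (fun m : ℕ => (m : ℝ)⁻¹ * ∑ j ∈ Finset.range m, reportProb x (S j).1 c) atTop
      (𝓝 (reportProb x M c)) := by
  have hcont : Continuous fun S : Matrix (Fin C) (Fin C) ℝ => reportProb x S c :=
    continuous_finsetSum _ fun b _ => continuous_const.mul (continuous_id.matrix_elem b c)
  refine ((hcont.tendsto M).comp h).congr fun m => ?_
  simp only [Function.comp_apply, reportProb, Matrix.smul_apply, Matrix.sum_apply, smul_eq_mul]
  rw [Finset.sum_comm, Finset.mul_sum]
  refine Finset.sum_congr rfl fun b _ => ?_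
  rw [← Finset.mul_sum]
  ring

theorem stateMatrix_mul_apply (a : Fin n → TaskState C) (M : Matrix (Fin C) (Fin C) ℝ)
    (t : Fin n) (c : Fin C) : (stateMatrix a * M) t c = reportProb (a t) M c := rfl

theorem sum_stateMatrix (a : Fin n → TaskState C) (t : Fin n) : ∑ c, stateMatrix a t c = 1 :=
  (a t).2.2

variable {a : Fin n → TaskState C} {ρ : ℕ → ProbabilityMeasure (Set (Fin n))} {p : Fin n → ℝ}
  {S : ℕ → Strategy C} {M : Matrix (Fin C) (Fin C) ℝ}

/-- The counts are sums of independent indicators whose means are linear in the strategies, so only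
the average strategy enters the limit. -/
theorem ae_tendsto_average_countMatrix
    (hρ : ∀ j t, (ρ j : Measure (Set (Fin n))).real {T | t ∈ T} = p t)
    (hS : HasLimitingStrategy S M) (t : Fin n) (c : Fin C) :
    ∀ᵐ w ∂(agentsLaw ρ S a), Tendsto (fun m : ℕ => (m : ℝ)⁻¹ *
      countMatrix (Finset.range m) (fun j => reportsOf (w j)) t c) atTop
      (𝓝 (p t * reportProb (a t) M c)) := by
  classical
  let f : AgentSample n C → ℝ := fun s => reportMatrix (reportsOf s) t c
  have hf : Measurable f := measurable_of_finite f
  have hind : iIndepFun (fun (j : ℕ) (w : ℕ → AgentSample n C) => f (w j)) (agentsLaw ρ S a) :=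
    iIndepFun_infinitePi (P := fun j => agentLaw (ρ j) (S j) a) (X := fun _ => f) fun _ => hf
  have hprob : IsProbabilityMeasure (agentsLaw ρ S a) := by unfold agentsLaw; infer_instance
  have hint : ∀ j, ∫ w, f (w j) ∂(agentsLaw ρ S a) = p t * reportProb (a t) (S j).1 c := by
    intro j
    have h₁ : ∫ w, f (w j) ∂(agentsLaw ρ S a) = ∫ s, f s ∂(agentLaw (ρ j) (S j) a) := by
      rw [← Measure.infinitePi_map_eval (fun j => agentLaw (ρ j) (S j) a) j,
        integral_map (measurable_pi_apply j).aemeasurable hf.aestronglyMeasurable]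
      rfl
    rw [h₁, ← hρ j t, ← agentLaw_real_report,
      ← integral_indicator_one (Set.toFinite _).measurableSet]
    refine integral_congr_ae (Eventually.of_forall fun s => ?_)
    by_cases hs : reportsOf s t = some c <;> simp [f, reportMatrix, hs]
  filter_upwards [ae_tendsto_average_sub_integral hind
    (fun j => hf.comp (measurable_pi_apply j)) fun j w => by
      simp only [f, reportMatrix]; split_ifs <;> simp] with w hw
  have hlim := hw.add ((hS.tendsto_reportProb (a t) c).const_mul (p t))
  rw [zero_add] at hlim
  refine hlim.congr fun m => ?_
  simp only [hint, Finset.sum_sub_distrib, countMatrix, Matrix.sum_apply, ← Finset.mul_sum, f]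
  ring

theorem ae_tendsto_answersOfFirst (hp : ∀ t, 0 < p t)
    (hρ : ∀ j t, (ρ j : Measure (Set (Fin n))).real {T | t ∈ T} = p t)
    (hS : HasLimitingStrategy S M) :
    ∀ᵐ w ∂(agentsLaw ρ S a), Tendsto (answersOfFirst w) atTop (𝓝 (stateMatrix a * M)) := by
  have h : ∀ᵐ w ∂(agentsLaw ρ S a), ∀ t c, Tendsto (fun m : ℕ => (m : ℝ)⁻¹ *
      countMatrix (Finset.range m) (fun j => reportsOf (w j)) t c) atTop
      (𝓝 (p t * reportProb (a t) M c)) :=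
    ae_all_iff.2 fun t => ae_all_iff.2 fun c => ae_tendsto_average_countMatrix hρ hS t c
  filter_upwards [h] with w hw
  refine tendsto_pi_nhds.2 fun t => tendsto_pi_nhds.2 fun c => ?_
  -- The normalizing row sums tend to `p t`, which is positive and cancels in the quotient.
  have hsum : ∑ c, p t * reportProb (a t) M c = p t := by
    rw [← Finset.mul_sum]
    have := sum_mul_rowStochastic (sum_stateMatrix a) hS.mem_rowStochastic t
    simp only [stateMatrix_mul_apply] at this
    rw [this, mul_one]
  have hden := tendsto_finsetSum Finset.univ fun c _ => hw t c
  rw [hsum] at hden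
  have hlim := (hw t c).div hden (hp t).ne'
  rw [mul_div_cancel_left₀ _ (hp t).ne'] at hlim
  refine hlim.congr' ?_
  filter_upwards [eventually_gt_atTop 0] with m hm
  have hm' : (m : ℝ)⁻¹ ≠ 0 := inv_ne_zero (by exact_mod_cast hm.ne')
  simp only [Pi.div_apply, ← Finset.mul_sum, answersOfFirst, answerMatrix]
  rw [mul_div_mul_left _ _ hm']

theorem sum_answerMatrix_eq_zero_or_one {ι : Type*} (J : Finset ι) (r : ι → Reports n C)
    (t : Fin n) : ∑ c, answerMatrix J r t c = 0 ∨ ∑ c, answerMatrix J r t c = 1 := by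
  simp only [answerMatrix, ← Finset.sum_div]
  rcases eq_or_ne (∑ c, countMatrix J r t c) 0 with h | h
  · simp [h]
  · exact Or.inr (div_self h)

/-- Row sums of answer matrices are `0` or `1`, so convergence to `1` forces equality in the end. -/
theorem eventually_sum_answersOfFirst {w : ℕ → AgentSample n C} {B : Matrix (Fin n) (Fin C) ℝ}
    (h : Tendsto (answersOfFirst w) atTop (𝓝 B)) (hB : ∀ t, ∑ c, B t c = 1) :
    ∀ᶠ m in atTop, ∀ t, ∑ c, answersOfFirst w m t c = 1 := by
  refine eventually_all.2 fun t => ?_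
  have hlim : Tendsto (fun m => ∑ c, answersOfFirst w m t c) atTop (𝓝 1) := by
    rw [← hB t]
    exact tendsto_finsetSum _ fun c _ => ((continuous_id.matrix_elem t c).tendsto B).comp h
  filter_upwards [hlim.eventually_ne one_ne_zero] with m hm
  exact (sum_answerMatrix_eq_zero_or_one _ _ t).resolve_left hm

theorem eventually_rank_eq {B : Matrix (Fin n) (Fin C) ℝ} {A : ℕ → Matrix (Fin n) (Fin C) ℝ}
    (h : Tendsto A atTop (𝓝 B)) (hB : B.rank = C) : ∀ᶠ m in atTop, (A m).rank = C := by
  have hopen := isOpen_setOfPred_linearIndependent (𝕜 := ℝ) (E := Fin n → ℝ) (ι := Fin C)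
  have hT : Tendsto (fun m => (A m).transpose) atTop (𝓝 B.transpose) :=
    (continuous_id.matrix_transpose.tendsto B).comp h
  filter_upwards [hT (hopen.mem_nhds ((linearIndependent_transpose_iff_rank B).2 hB))] with m hm
  exact (linearIndependent_transpose_iff_rank (A m)).1 hm

/-- Full column rank is an open condition, whereas a smaller rank could jump up along the sequence.
Once the rank and the row sums are right, `B m` and `A₀ * M` may replace the picked columns. -/
theorem eventually_dmiClusteringsRefine {A₀ : Matrix (Fin n) (Fin C) ℝ}
    {B : ℕ → Matrix (Fin n) (Fin C) ℝ} (hA₀ : ∀ t, ∑ c, A₀ t c = 1) (hr : A₀.rank = C)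
    (hM : IsUnit M) (hB : Tendsto B atTop (𝓝 (A₀ * M)))
    (hsum : ∀ᶠ m in atTop, ∀ t, ∑ c, B m t c = 1) :
    ∀ᶠ m in atTop, DMIClusteringsRefine (B m) A₀ := by
  have hrM : (A₀ * M).rank = C := by
    rw [rank_eq_finrank_colSpan, colSpan_mul_of_isUnit hM, ← rank_eq_finrank_colSpan, hr]
  filter_upwards [hsum, eventually_rank_eq hB hrM, eventually_detMaximizers_subset hB]
    with m hsm hrm hsub
  have hA₀k := (isColumnChoice_inl hA₀ hr).1
  have hBk := (isColumnChoice_inl hsm hrm).1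
  refine ⟨hBk.symm.trans hA₀k, ?_⟩
  rintro k L L' hL hL'
  obtain rfl : k = C := hL.1.trans hBk.symm
  refine (subset_upToRelabeling _).trans ?_
  rw [upToRelabeling_detMaximizers_pickCols hsm hrm hL,
    upToRelabeling_detMaximizers_pickCols hA₀ hr hL', ← upToRelabeling_detMaximizers_mul A₀
      ((Matrix.isUnit_iff_isUnit_det _).1 hM).ne_zero]
  exact upToRelabeling_subset (hsub.trans (subset_upToRelabeling _))

end Limits

/-! ### Sums of determinants over independent rows -/

section DetSums

variable {τ V κ : Type*} [Fintype τ] [DecidableEq τ] [Fintype V] [Fintype κ]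

/-- Independence over tasks: by injectivity every task carries at most one factor `ψ c`, and each
unused task contributes the total mass. -/
theorem sum_prod_mul_prod_of_injective {f : κ → τ} (hf : Function.Injective f) (w : V → ℝ)
    (ψ : κ → V → ℝ) :
    ∑ z : τ → V, (∏ t, w (z t)) * ∏ c, ψ c (z (f c)) =
      (∑ v, w v) ^ (Fintype.card τ - Fintype.card κ) * ∏ c, ∑ v, w v * ψ c v := by
  classical
  let g : τ → V → ℝ := fun t v => w v * ∏ c with f c = t, ψ c v
  have hg : ∀ z : τ → V, (∏ t, w (z t)) * ∏ c, ψ c (z (f c)) = ∏ t, g t (z t) := fun z => by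
    rw [Finset.prod_mul_distrib, ← Finset.prod_fiberwise Finset.univ f fun c => ψ c (z (f c))]
    congr 1
    refine Finset.prod_congr rfl fun t _ => Finset.prod_congr rfl fun c hc => ?_
    rw [(Finset.mem_filter.1 hc).2]
  rw [Finset.sum_congr rfl fun z _ => hg z, ← Fintype.prod_sum g,
    ← Finset.prod_compl_mul_prod (Finset.univ.image f)]
  congr 1
  · rw [Finset.prod_congr rfl (g := fun _ => ∑ v, w v), Finset.prod_const, Finset.card_compl,
      Finset.card_image_of_injective _ hf, Finset.card_univ]
    intro t ht
    have : ∀ c, f c ≠ t := fun c hc => Finset.mem_compl.1 ht (by simp [← hc])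
    simp [g, this]
  · rw [Finset.prod_image fun c _ d _ h => hf h]
    refine Finset.prod_congr rfl fun c _ => ?_
    have : Finset.univ.filter (fun d => f d = f c) = {c} := by
      ext d
      simp [hf.eq_iff]
    simp [g, this]

/-- Multilinearity picks one task `f c` for each column `c`. -/
theorem det_sum_mul_eq {C : ℕ} (s : Finset τ) (k ξ : τ → Fin C → ℝ) :
    (Matrix.of fun x c => ∑ t ∈ s, k t x * ξ t c).det =
      ∑ f : Fin C → τ with Function.Injective f ∧ ∀ c, f c ∈ s,
        ∑ σ : Equiv.Perm (Fin C), (Equiv.Perm.sign σ : ℝ) * ∏ c, k (f c) (σ c) * ξ (f c) c := by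
  have hfilter : (Finset.univ.filter fun f : Fin C → τ => Function.Injective f ∧ ∀ c, f c ∈ s) =
      (Fintype.piFinset fun _ : Fin C => s).filter fun f => Function.Injective f := by
    ext f
    simp [and_comm]
  rw [Matrix.det_apply', hfilter, Finset.sum_filter_of_ne]
  · simp only [Matrix.of_apply, Finset.prod_univ_sum, Finset.mul_sum]
    rw [Finset.sum_comm]
  · intro f _ hne
    by_contra hinj
    apply hne
    obtain ⟨c, d, hcd, hne'⟩ := Function.not_injective_iff.1 hinj
    -- If two columns pick the same task, the alternating sum over `σ` is a determinant with two
    -- equal columns.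
    have h0 := Matrix.det_zero_of_column_eq (M := Matrix.of fun x c => k (f c) x) hne'
      fun x => by simp [hcd]
    rw [Matrix.det_apply'] at h0
    simp only [Finset.prod_mul_distrib, ← mul_assoc, ← Finset.sum_mul]
    rw [← zero_mul (∏ c, ξ (f c) c), ← h0]
    rfl

/-- The constants are chosen before the weights, so they agree for a strategy and for truth-telling.
-/
theorem exists_sum_prod_mul_det_mul_det {C : ℕ} {s₁ s₂ : Finset τ} (hs : Disjoint s₁ s₂) :
    ∃ N e : ℕ, ∀ (w : V → ℝ) (K X : V → Fin C → ℝ),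
      ∑ z : τ → V, (∏ t, w (z t)) *
        ((Matrix.of fun x c => ∑ t ∈ s₁, K (z t) x * X (z t) c).det *
          (Matrix.of fun x c => ∑ t ∈ s₂, K (z t) x * X (z t) c).det) =
      N * (∑ v, w v) ^ e * (Matrix.of fun x c => ∑ v, w v * (K v x * X v c)).det ^ 2 := by
  classical
  let E : Finset τ → Finset (Fin C → τ) := fun s =>
    Finset.univ.filter fun f => Function.Injective f ∧ ∀ c, f c ∈ s
  -- The truncated subtraction is harmless: with fewer than `2C` tasks no pair of injections with
  -- disjoint ranges exists, and the count is `0`.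
  refine ⟨(E s₁ ×ˢ E s₂).card, Fintype.card τ - Fintype.card (Fin C ⊕ Fin C), fun w K X => ?_⟩
  let U : Matrix (Fin C) (Fin C) ℝ := Matrix.of fun x c => ∑ v, w v * (K v x * X v c)
  let W := (∑ v, w v) ^ (Fintype.card τ - Fintype.card (Fin C ⊕ Fin C))
  have hpair : ∀ f ∈ E s₁ ×ˢ E s₂, ∀ σ₁ σ₂ : Equiv.Perm (Fin C),
      ∑ z : τ → V, (∏ t, w (z t)) *
        ((∏ c, K (z (f.1 c)) (σ₁ c) * X (z (f.1 c)) c) *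
          ∏ c, K (z (f.2 c)) (σ₂ c) * X (z (f.2 c)) c) =
      W * ((∏ c, U (σ₁ c) c) * ∏ c, U (σ₂ c) c) := by
    intro f hf σ₁ σ₂
    simp only [E, Finset.mem_product, Finset.mem_filter, Finset.mem_univ, true_and] at hf
    -- Disjointness of the parts makes the tasks of both determinants jointly distinct, so the
    -- expectation factors.
    have hinj : Function.Injective (Sum.elim f.1 f.2) :=
      hf.1.1.sumElim hf.2.1 fun c d h =>
        Finset.disjoint_left.1 hs (hf.1.2 c) (h ▸ hf.2.2 d)
    have h := sum_prod_mul_prod_of_injective hinj w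
      (Sum.elim (fun c v => K v (σ₁ c) * X v c) fun c v => K v (σ₂ c) * X v c)
    simp only [Fintype.prod_sum_type, Sum.elim_inl, Sum.elim_inr] at h
    exact h
  have hexp : ∀ z : τ → V, (∏ t, w (z t)) *
        ((Matrix.of fun x c => ∑ t ∈ s₁, K (z t) x * X (z t) c).det *
          (Matrix.of fun x c => ∑ t ∈ s₂, K (z t) x * X (z t) c).det) =
      ∑ f ∈ E s₁ ×ˢ E s₂, ∑ σ₁ : Equiv.Perm (Fin C), ∑ σ₂ : Equiv.Perm (Fin C),
        ((Equiv.Perm.sign σ₁ : ℝ) * (Equiv.Perm.sign σ₂ : ℝ)) * ((∏ t, w (z t)) *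
          ((∏ c, K (z (f.1 c)) (σ₁ c) * X (z (f.1 c)) c) *
            ∏ c, K (z (f.2 c)) (σ₂ c) * X (z (f.2 c)) c)) := by
    intro z
    rw [det_sum_mul_eq s₁ (fun t => K (z t)) fun t => X (z t),
      det_sum_mul_eq s₂ (fun t => K (z t)) fun t => X (z t), Finset.sum_mul_sum,
      ← Finset.sum_product', Finset.mul_sum]
    refine Finset.sum_congr rfl fun f _ => ?_
    rw [Finset.sum_mul_sum, Finset.mul_sum]
    refine Finset.sum_congr rfl fun σ₁ _ => ?_
    rw [Finset.mul_sum]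
    refine Finset.sum_congr rfl fun σ₂ _ => ?_
    ring
  rw [Finset.sum_congr rfl fun z _ => hexp z, Finset.sum_comm,
    Finset.sum_congr rfl (g := fun _ => W * U.det ^ 2), Finset.sum_const, nsmul_eq_mul, mul_assoc]
  intro f hf
  rw [Finset.sum_comm, Matrix.det_apply', sq, Finset.sum_mul_sum, Finset.mul_sum]
  refine Finset.sum_congr rfl fun σ₁ _ => ?_
  rw [Finset.sum_comm, Finset.mul_sum]
  refine Finset.sum_congr rfl fun σ₂ _ => ?_
  rw [← Finset.mul_sum, hpair f hf]
  ring

theorem sum_prod_split (p : τ → Prop) [DecidablePred p] [Fintype {t // p t}]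
    [Fintype {t // ¬p t}] (w : τ → V → ℝ) (H : (τ → V) → ℝ) :
    ∑ z : τ → V, (∏ t, w t (z t)) * H z =
      ∑ u : {t // ¬p t} → V, (∏ t : {t // ¬p t}, w t (u t)) *
        ∑ y : {t // p t} → V, (∏ t : {t // p t}, w t (y t)) *
        H ((Equiv.piEquivPiSubtypeProd p fun _ => V).symm (y, u)) := by
  rw [← Equiv.sum_comp (Equiv.piEquivPiSubtypeProd p fun _ => V).symm, Fintype.sum_prod_type,
    Finset.sum_comm]
  refine Finset.sum_congr rfl fun u _ => ?_
  rw [Finset.mul_sum]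
  refine Finset.sum_congr rfl fun y _ => ?_
  rw [← mul_assoc, ← Fintype.prod_subtype_mul_prod_subtype p]
  congr 1
  rw [mul_comm]
  congr 1 <;>
  · refine Finset.prod_congr (by ext; simp) fun t _ => ?_
    simp [Equiv.piEquivPiSubtypeProd, t.2]

end DetSums

/-! ### The payment in terms of the reports on each task -/

section Payment

variable {n C : ℕ}

theorem sqDet_transpose_rowsOf_mul {k : ℕ} (s : Finset (Fin n)) (E : Matrix (Fin n) (Fin k) ℝ)
    (R : Matrix (Fin n) (Fin C) ℝ) :
    sqDet ((rowsOf s E).transpose * rowsOf s R) =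
      if h : k = C then
        (Matrix.of fun x c => ∑ t ∈ s, E t (Fin.cast h.symm x) * R t c).det else 0 := by
  unfold sqDet
  split_ifs with h
  · subst h
    congr 1
    ext x c
    exact Finset.sum_coe_sort s fun t => E t x * R t c
  · rfl

variable {ι : Type*} [Fintype ι] [DecidableEq ι]

/-- The answer row of a task on which the reports are `v`, for the agents other than `i`. -/
noncomputable def answerRow (i : ι) (v : ι → Option (Fin C)) : Fin C → ℝ := fun c =>
  (∑ j ∈ Finset.univ.erase i, if v j = some c then (1 : ℝ) else 0) /
    ∑ c', ∑ j ∈ Finset.univ.erase i, if v j = some c' then (1 : ℝ) else 0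

theorem answerMatrix_erase_apply (r : ι → Reports n C) (i : ι) (t : Fin n) (c : Fin C) :
    answerMatrix (Finset.univ.erase i) r t c = answerRow i (fun j => r j t) c := by
  simp only [answerMatrix, answerRow, countMatrix, Matrix.sum_apply, reportMatrix]

theorem answerRow_update (i : ι) (v : ι → Option (Fin C)) (o : Option (Fin C)) :
    answerRow i (Function.update v i o) = answerRow i v := by
  have : ∀ c, ∑ j ∈ Finset.univ.erase i,
      (if Function.update v i o j = some c then (1 : ℝ) else 0) =
      ∑ j ∈ Finset.univ.erase i, if v j = some c then (1 : ℝ) else 0 := fun c =>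
    Finset.sum_congr rfl fun j hj => by
      rw [Function.update_of_ne (Finset.ne_of_mem_erase hj)]
  funext c
  simp only [answerRow, this]

/-- The clustering rule learned from the rows of `B`, applied to one row; it is zero unless there
are `C` clusters. -/
noncomputable def clusterOf (ch : KDMIChoices n C) (U : Finset (Fin n))
    (B : Matrix U (Fin C) ℝ) (row : Fin C → ℝ) : Fin C → ℝ :=
  if h : (ch.solver U B).k = C then fun x =>
    ch.tie _ (Matrix.vecMul (fun l => Sum.elim row (fun _ => 1) ((ch.solver U B).L l))
      ((ch.solver U B).D B)) (Fin.cast h.symm x)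
  else 0

theorem clusterOf_eq (ch : KDMIChoices n C) (U : Finset (Fin n)) (B : Matrix U (Fin C) ℝ)
    (h : (ch.solver U B).k = C) :
    clusterOf ch U B = fun row x =>
      ch.tie _ (Matrix.vecMul (fun l => Sum.elim row (fun _ => 1) ((ch.solver U B).L l))
        ((ch.solver U B).D B)) (Fin.cast h.symm x) := by
  funext row
  exact dif_pos h

/-- Whether the rows of `B` give rise to `C` clusters. -/
noncomputable def fullRankIndicator (ch : KDMIChoices n C) (U : Finset (Fin n))
    (B : Matrix U (Fin C) ℝ) : ℝ :=
  if (ch.solver U B).k = C then 1 else 0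

theorem fullRankIndicator_nonneg (ch : KDMIChoices n C) (U : Finset (Fin n))
    (B : Matrix U (Fin C) ℝ) : 0 ≤ fullRankIndicator ch U B := by
  unfold fullRankIndicator
  split_ifs <;> simp

/-- The tasks outside `T` on which an agent other than `i` made a report, when `z t` lists the
reports on task `t`. -/
def reportedOutside (T : Finset (Fin n)) (i : ι) (z : Fin n → ι → Option (Fin C)) :
    Finset (Fin n) :=
  Finset.univ.filter fun t => t ∉ T ∧ ∃ j, j ≠ i ∧ z t j ≠ none

/-- The matrix of the answers of the agents other than `i`. -/
noncomputable def answersExcept (i : ι) (z : Fin n → ι → Option (Fin C)) :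
    Matrix (Fin n) (Fin C) ℝ :=
  fun t => answerRow i (z t)

/-- The determinant that enters the payment for the tasks in `s`, if the clustering rule is `K`. -/
noncomputable def agreementDet {τ : Type*} (i : ι) (s : Finset τ) (K : (Fin C → ℝ) → Fin C → ℝ)
    (z : τ → ι → Option (Fin C)) : ℝ :=
  (Matrix.of fun x c => ∑ t ∈ s, K (answerRow i (z t)) x *
    if z t i = some c then (1 : ℝ) else 0).det

/-- Once `T` is known, the indicator and the clustering rule involve only tasks outside `T`, and the
two determinants use that rule on tasks inside `T`. -/
theorem payment_eq (ch : KDMIChoices n C) (i : ι) (z : Fin n → ι → Option (Fin C))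
    {T : Finset (Fin n)} (hT : performed (fun t => z t i) = T) :
    payment ch (fun j t => z t j) i =
      if 2 * C ≤ T.card then
        fullRankIndicator ch (reportedOutside T i z)
            (rowsOf (reportedOutside T i z) (answersExcept i z)) *
          (agreementDet i (ch.part₁ T)
              (clusterOf ch (reportedOutside T i z)
                (rowsOf (reportedOutside T i z) (answersExcept i z))) z *
            agreementDet i (ch.part₂ T)
              (clusterOf ch (reportedOutside T i z)
                (rowsOf (reportedOutside T i z) (answersExcept i z))) z)
      else 0 := by
  have hU : learningTasks (fun j t => z t j) i = reportedOutside T i z := by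
    ext t
    simp [learningTasks, reportedOutside, ← hT, performed]
  have hA : answerMatrix (Finset.univ.erase i) (fun j t => z t j) = answersExcept i z := by
    ext t c
    exact answerMatrix_erase_apply _ i t c
  unfold payment
  rw [hT]
  split_ifs with hcard
  · rw [sqDet_transpose_rowsOf_mul, sqDet_transpose_rowsOf_mul]
    unfold inducedClusters learned
    rw [hA, hU]
    unfold fullRankIndicator
    split_ifs with hk
    · rw [one_mul]
      rw [clusterOf_eq ch _ _ hk]
      rfl
    · rw [zero_mul, zero_mul]
  · rfl

theorem reportedOutside_congr {T : Finset (Fin n)} (i : ι) {z z' : Fin n → ι → Option (Fin C)}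
    (h : ∀ t, t ∉ T → z t = z' t) : reportedOutside T i z = reportedOutside T i z' := by
  ext t
  simp only [reportedOutside, Finset.mem_filter, Finset.mem_univ, true_and]
  exact and_congr_right fun ht => by rw [h t ht]

theorem rowsOf_answersExcept_congr {T : Finset (Fin n)} (i : ι)
    {z z' y : Fin n → ι → Option (Fin C)} (h : ∀ t, t ∉ T → z t = z' t) :
    rowsOf (reportedOutside T i y) (answersExcept i z) =
      rowsOf (reportedOutside T i y) (answersExcept i z') := by
  ext t c
  have : (t : Fin n) ∉ T := (Finset.mem_filter.1 t.2).2.1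
  simp only [rowsOf, Matrix.submatrix_apply, answersExcept, h t this]

end Payment

/-! ### Garbling the reports of one agent -/

section Garbling

variable {n C : ℕ} {ι : Type*} [Fintype ι] [DecidableEq ι]

/-- The weights `ν` of the lists of reports on one task arise from `ν₁` when the report of agent
`i` is replaced at random according to `S`. -/
structure IsGarbling (i : ι) (S : Strategy C) (ν ν₁ : (ι → Option (Fin C)) → ℝ) : Prop where
  nonneg : ∀ v, 0 ≤ ν₁ v
  eq_of_none : ∀ v, v i = none → ν v = ν₁ v
  eq_of_some : ∀ v c, v i = some c → ν v = ∑ b, S.1 b c * ν₁ (Function.update v i (some b))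

variable {i : ι} {S : Strategy C} {ν ν₁ : (ι → Option (Fin C)) → ℝ}

/-- This is `U = U₁ * S` entrywise. Changing the report of `i` matches the lists with report `c` to
those with report `b`, and `φ` does not notice. -/
theorem IsGarbling.sum_mul_eq (h : IsGarbling i S ν ν₁) {φ : (ι → Option (Fin C)) → ℝ}
    (hφ : ∀ v o, φ (Function.update v i o) = φ v) (c : Fin C) :
    ∑ v, ν v * (φ v * if v i = some c then (1 : ℝ) else 0) =
      ∑ b, (∑ v, ν₁ v * (φ v * if v i = some b then (1 : ℝ) else 0)) * S.1 b c := by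
  simp only [mul_ite, mul_one, mul_zero, ← Finset.sum_filter, Finset.sum_mul]
  rw [Finset.sum_congr rfl fun v hv => by
    rw [h.eq_of_some v c (Finset.mem_filter.1 hv).2, Finset.sum_mul], Finset.sum_comm]
  refine Finset.sum_congr rfl fun b _ => ?_
  refine Finset.sum_nbij' (fun v => Function.update v i (some b))
    (fun v => Function.update v i (some c)) ?_ ?_ ?_ ?_ ?_
  · simp
  · simp
  · intro v hv
    simp [← (Finset.mem_filter.1 hv).2]
  · intro v hv
    simp [← (Finset.mem_filter.1 hv).2]
  · intro v _
    rw [hφ]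
    ring

/-- The part of the weights carried by lists in which agent `i` reports. -/
noncomputable def reportingPart (i : ι) (ν : (ι → Option (Fin C)) → ℝ)
    (v : ι → Option (Fin C)) : ℝ :=
  ν v * if v i ≠ none then 1 else 0

theorem sum_reportingPart_mul (i : ι) (ν φ : (ι → Option (Fin C)) → ℝ) (c : Fin C) :
    ∑ v, reportingPart i ν v * (φ v * if v i = some c then (1 : ℝ) else 0) =
      ∑ v, ν v * (φ v * if v i = some c then (1 : ℝ) else 0) := by
  refine Finset.sum_congr rfl fun v _ => ?_
  by_cases hv : v i = some c <;> simp [reportingPart, hv]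

theorem sum_reportingPart (i : ι) (ν : (ι → Option (Fin C)) → ℝ) :
    ∑ v, reportingPart i ν v = ∑ c, ∑ v, ν v * (1 * if v i = some c then (1 : ℝ) else 0) := by
  rw [Finset.sum_comm]
  refine Finset.sum_congr rfl fun v _ => ?_
  cases hv : v i <;> simp [reportingPart, hv]

/-- Garbling moves mass between the reports of `i` without losing any, as the rows of `S` sum to
one. -/
theorem IsGarbling.sum_reportingPart_eq (h : IsGarbling i S ν ν₁) :
    ∑ v, reportingPart i ν v = ∑ v, reportingPart i ν₁ v := by
  rw [sum_reportingPart, sum_reportingPart,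
    Finset.sum_congr rfl fun c _ => h.sum_mul_eq (φ := fun _ => 1) (fun _ _ => rfl) c,
    Finset.sum_comm]
  refine Finset.sum_congr rfl fun b _ => ?_
  rw [← Finset.mul_sum, Matrix.sum_row_of_mem_rowStochastic S.2, mul_one]

theorem agreementDet_piEquivPiSubtypeProd {τ : Type*} {p : τ → Prop} [DecidablePred p]
    (s : Finset τ) (hs : ∀ t ∈ s, p t) (K : (Fin C → ℝ) → Fin C → ℝ)
    (y : {t // p t} → ι → Option (Fin C)) (u : {t // ¬p t} → ι → Option (Fin C)) :
    agreementDet i s K ((Equiv.piEquivPiSubtypeProd p fun _ => ι → Option (Fin C)).symm (y, u)) =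
      agreementDet i (s.subtype p) K y := by
  unfold agreementDet
  congr 1
  ext x c
  simp only [Matrix.of_apply]
  rw [← Finset.sum_subtype_of_mem _ hs]
  refine Finset.sum_congr rfl fun t _ => ?_
  simp [Equiv.piEquivPiSubtypeProd, t.2]

/-- Both sides are the same nonnegative constant times a squared determinant, and the determinants
differ by the factor `det S`. -/
theorem IsGarbling.sum_agreementDet_le (h : IsGarbling i S ν ν₁) {τ : Type*} [Fintype τ]
    [DecidableEq τ] {s₁ s₂ : Finset τ} (hs : Disjoint s₁ s₂) (K : (Fin C → ℝ) → Fin C → ℝ) :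
    ∑ y : τ → ι → Option (Fin C), (∏ t, reportingPart i ν (y t)) *
        (agreementDet i s₁ K y * agreementDet i s₂ K y) ≤
      ∑ y : τ → ι → Option (Fin C), (∏ t, reportingPart i ν₁ (y t)) *
        (agreementDet i s₁ K y * agreementDet i s₂ K y) := by
  obtain ⟨N, e, hN⟩ := exists_sum_prod_mul_det_mul_det (V := ι → Option (Fin C)) (C := C) hs
  have hval : ∀ w, _ = _ := fun w => hN w (fun v => K (answerRow i v))
    fun v c => if v i = some c then (1 : ℝ) else 0
  unfold agreementDet
  rw [hval, hval, h.sum_reportingPart_eq]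
  have hU : (Matrix.of fun x c => ∑ v, reportingPart i ν v *
        (K (answerRow i v) x * if v i = some c then (1 : ℝ) else 0)) =
      (Matrix.of fun x c => ∑ v, reportingPart i ν₁ v *
        (K (answerRow i v) x * if v i = some c then (1 : ℝ) else 0)) * S.1 := by
    ext x c
    simp only [Matrix.mul_apply, Matrix.of_apply, sum_reportingPart_mul]
    exact h.sum_mul_eq (φ := fun v => K (answerRow i v) x)
      (fun v o => by simp only [answerRow_update]) c
  rw [hU, Matrix.det_mul, mul_pow]
  have hW : 0 ≤ ∑ v, reportingPart i ν₁ v :=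
    Finset.sum_nonneg fun v _ => mul_nonneg (h.nonneg v) (by split_ifs <;> simp)
  refine mul_le_mul_of_nonneg_left (mul_le_of_le_one_right (sq_nonneg _) ?_) (by positivity)
  rw [sq_le_one_iff_abs_le_one]
  exact abs_det_le_one_of_mem_rowStochastic S.2

theorem IsGarbling.sum_payment_le (h : IsGarbling i S ν ν₁) (ch : KDMIChoices n C)
    (T : Finset (Fin n)) :
    ∑ z : Fin n → ι → Option (Fin C), (∏ t, ν (z t)) *
        (if performed (fun t => z t i) = T then payment ch (fun j t => z t j) i else 0) ≤
      ∑ z : Fin n → ι → Option (Fin C), (∏ t, ν₁ (z t)) *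
        (if performed (fun t => z t i) = T then payment ch (fun j t => z t j) i else 0) := by
  rcases lt_or_ge T.card (2 * C) with hcard | hcard
  · have h0 : ∀ z : Fin n → ι → Option (Fin C), (if performed (fun t => z t i) = T then
        payment ch (fun j t => z t j) i else 0) = 0 := fun z => by
      split_ifs with hT
      · rw [payment_eq ch i z hT, if_neg (not_le.2 hcard)]
      · rfl
    simp only [h0, mul_zero, le_refl]
  -- The event that `i` performs exactly `T` is distributed over the tasks, so that the weights stay
  -- a product.
  let w : ((ι → Option (Fin C)) → ℝ) → Fin n → (ι → Option (Fin C)) → ℝ := fun ν t v =>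
    if v i ≠ none ↔ t ∈ T then ν v else 0
  let θ : (Fin n → ι → Option (Fin C)) → ℝ := fun z => fullRankIndicator ch
    (reportedOutside T i z) (rowsOf (reportedOutside T i z) (answersExcept i z))
  let K : (Fin n → ι → Option (Fin C)) → (Fin C → ℝ) → Fin C → ℝ := fun z =>
    clusterOf ch (reportedOutside T i z) (rowsOf (reportedOutside T i z) (answersExcept i z))
  have hterm : ∀ (ν : (ι → Option (Fin C)) → ℝ) (z : Fin n → ι → Option (Fin C)),
      (∏ t, ν (z t)) *
        (if performed (fun t => z t i) = T then payment ch (fun j t => z t j) i else 0) =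
      (∏ t, w ν t (z t)) * (θ z *
        (agreementDet i (ch.part₁ T) (K z) z * agreementDet i (ch.part₂ T) (K z) z)) := by
    intro ν z
    have hiff : performed (fun t => z t i) = T ↔ ∀ t ∈ Finset.univ, (z t i ≠ none ↔ t ∈ T) := by
      simp [performed, Finset.ext_iff]
    simp only [w]
    rw [Finset.prod_ite_zero]
    split_ifs with h₁ h₂ h₂
    · rw [payment_eq ch i z h₁, if_pos hcard]
    · exact absurd (hiff.1 h₁) h₂
    · exact absurd (hiff.2 h₂) h₁
    · simp
  have hT₁ : ∀ t ∈ ch.part₁ T, t ∈ T := fun t ht => by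
    rw [← ch.part_union T]; exact Finset.mem_union_left _ ht
  have hT₂ : ∀ t ∈ ch.part₂ T, t ∈ T := fun t ht => by
    rw [← ch.part_union T]; exact Finset.mem_union_right _ ht
  have hdisj : Disjoint ((ch.part₁ T).subtype (· ∈ T)) ((ch.part₂ T).subtype (· ∈ T)) := by
    rw [Finset.disjoint_left]
    intro t ht ht'
    exact Finset.disjoint_left.1 (ch.part_disjoint T) (Finset.mem_subtype.1 ht)
      (Finset.mem_subtype.1 ht')
  let glue : ({t // t ∈ T} → ι → Option (Fin C)) → ({t // t ∉ T} → ι → Option (Fin C)) →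
      Fin n → ι → Option (Fin C) := fun y u =>
    (Equiv.piEquivPiSubtypeProd (· ∈ T) fun _ => ι → Option (Fin C)).symm (y, u)
  -- The filler `none` inside `T` is arbitrary: it shows that the indicator and the rule depend on
  -- `u` alone.
  have hglue : ∀ y u t, t ∉ T → glue y u t = glue (fun _ _ => none) u t := by
    intro y u t ht
    simp [glue, Equiv.piEquivPiSubtypeProd, ht]
  have hθ : ∀ y u, θ (glue y u) = θ (glue (fun _ _ => none) u) := fun y u => by
    simp only [θ]
    rw [reportedOutside_congr i (hglue y u), rowsOf_answersExcept_congr i (hglue y u)]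
  have hK : ∀ y u, K (glue y u) = K (glue (fun _ _ => none) u) := fun y u => by
    simp only [K]
    rw [reportedOutside_congr i (hglue y u), rowsOf_answersExcept_congr i (hglue y u)]
  have hsum : ∀ ν : (ι → Option (Fin C)) → ℝ,
      ∑ z : Fin n → ι → Option (Fin C), (∏ t, ν (z t)) *
        (if performed (fun t => z t i) = T then payment ch (fun j t => z t j) i else 0) =
      ∑ u : {t // t ∉ T} → ι → Option (Fin C), ((∏ t : {t // t ∉ T}, w ν t (u t)) *
        θ (glue (fun _ _ => none) u)) *
        ∑ y : {t // t ∈ T} → ι → Option (Fin C), (∏ t, reportingPart i ν (y t)) *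
          (agreementDet i ((ch.part₁ T).subtype (· ∈ T)) (K (glue (fun _ _ => none) u)) y *
            agreementDet i ((ch.part₂ T).subtype (· ∈ T)) (K (glue (fun _ _ => none) u)) y) := by
    intro ν
    rw [Finset.sum_congr rfl fun z _ => hterm ν z, sum_prod_split (· ∈ T) (w ν)]
    refine Finset.sum_congr rfl fun u _ => ?_
    rw [mul_assoc]
    congr 1
    rw [Finset.mul_sum]
    refine Finset.sum_congr rfl fun y _ => ?_
    change _ * (θ (glue y u) * (agreementDet i (ch.part₁ T) (K (glue y u)) (glue y u) *
      agreementDet i (ch.part₂ T) (K (glue y u)) (glue y u))) = _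
    rw [hθ, hK, agreementDet_piEquivPiSubtypeProd _ hT₁, agreementDet_piEquivPiSubtypeProd _ hT₂,
      Finset.prod_congr rfl (g := fun t : {t // t ∈ T} => reportingPart i ν (y t))]
    · ring
    · intro t _
      simp [w, reportingPart, t.2]
  rw [hsum, hsum]
  refine Finset.sum_le_sum fun u _ => ?_
  -- Outside `T` agent `i` makes no report, so her strategy has no effect there.
  have hw : ∀ t : {t // t ∉ T}, w ν t (u t) = w ν₁ t (u t) := fun t => by
    simp only [w]
    split_ifs with hu
    · exact h.eq_of_none _ (by simpa [t.2] using hu)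
    · rfl
  rw [Finset.prod_congr rfl fun t _ => hw t]
  refine mul_le_mul_of_nonneg_left (h.sum_agreementDet_le hdisj _) (mul_nonneg ?_ ?_)
  · refine Finset.prod_nonneg fun t _ => ?_
    simp only [w]
    split_ifs
    · exact h.nonneg _
    · exact le_rfl
  · exact fullRankIndicator_nonneg ch _ _

end Garbling

/-! ### The expected payment -/

section ExpectedPayment

variable {n C : ℕ}

theorem continuous_reportProb (S : Matrix (Fin C) (Fin C) ℝ) (c : Fin C) :
    Continuous fun x : TaskState C => reportProb x S c :=
  continuous_finsetSum _ fun b _ =>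
    ((continuous_apply b).comp continuous_subtype_val).mul continuous_const

theorem continuous_reportFactor (S : Matrix (Fin C) (Fin C) ℝ) (o : Option (Fin C)) :
    Continuous fun x : TaskState C => reportFactor x S o := by
  cases o with
  | none => exact continuous_const
  | some c => exact continuous_reportProb S c

theorem reportFactor_nonneg (x : TaskState C) (S : Strategy C) (o : Option (Fin C)) :
    0 ≤ reportFactor x S.1 o := by
  cases o with
  | none => exact zero_le_one
  | some c => exact reportProb_nonneg x S c

theorem integrable_of_continuous_of_compactSpace {X : Type*} [TopologicalSpace X] [CompactSpace X]
    [MeasurableSpace X] [BorelSpace X] {P : Measure X} [IsFiniteMeasure P] {f : X → ℝ}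
    (hf : Continuous f) : Integrable f P :=
  hf.integrable_of_hasCompactSupport (HasCompactSupport.of_compactSpace f)

variable {ι : Type*} [Fintype ι] [DecidableEq ι]

theorem expectedPaymentGiven_eq_sum (ch : KDMIChoices n C)
    (ρ : ι → ProbabilityMeasure (Set (Fin n))) (S : ι → Strategy C) (i : ι)
    (a : Fin n → TaskState C) :
    expectedPaymentGiven ch ρ S i a = ∑ r : ι → Reports n C,
      (∏ j, (agentLaw (ρ j) (S j) a).real (reportsOf ⁻¹' {r j})) * payment ch r i := by
  classical
  have hset : ∀ r : ι → Reports n C,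
      {w : ι → AgentSample n C | (fun j => reportsOf (w j)) = r} =
        Set.univ.pi fun j => reportsOf ⁻¹' {r j} := fun r => by
    ext w
    simp [funext_iff]
  have hind : ∀ w : ι → AgentSample n C, payment ch (fun j => reportsOf (w j)) i =
      ∑ r : ι → Reports n C, {w : ι → AgentSample n C | (fun j => reportsOf (w j)) = r}.indicator
        (fun _ => payment ch r i) w := fun w => by
    rw [Finset.sum_eq_single fun j => reportsOf (w j)]
    · simp
    · intro r _ hr
      have hw : w ∉ {w : ι → AgentSample n C | (fun j => reportsOf (w j)) = r} := fun h =>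
        hr (Eq.symm h)
      rw [Set.indicator_of_notMem hw]
    · simp
  have hprob : IsProbabilityMeasure (agentsLaw ρ S a) := by unfold agentsLaw; infer_instance
  unfold expectedPaymentGiven
  simp only [hind]
  rw [integral_finsetSum _ fun r _ => Integrable.of_finite]
  refine Finset.sum_congr rfl fun r _ => ?_
  rw [integral_indicator_const _ (Set.toFinite _).measurableSet, smul_eq_mul, hset, agentsLaw,
    Measure.infinitePi_eq_pi, Measure.real, Measure.pi_pi, ENNReal.toReal_prod]
  rfl

/-- The payment takes finitely many values with probabilities polynomial in the states; compactness
of the state space then gives integrability. -/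
theorem continuous_expectedPaymentGiven (ch : KDMIChoices n C)
    (ρ : ι → ProbabilityMeasure (Set (Fin n))) (S : ι → Strategy C) (i : ι) :
    Continuous (expectedPaymentGiven ch ρ S i) := by
  have : expectedPaymentGiven ch ρ S i = _ :=
    funext fun a => expectedPaymentGiven_eq_sum ch ρ S i a
  rw [this]
  refine continuous_finsetSum _ fun r _ =>
    (continuous_finsetProd _ fun j _ => ?_).mul continuous_const
  simp only [agentLaw_real_preimage_reportsOf]
  exact continuous_const.mul (continuous_finsetProd _ fun t _ =>
    (continuous_reportFactor _ _).comp (continuous_apply t))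

/-- The probability that an agent who performs a task with probability `q` gives the report `o`,
where `none` means that she does not perform it. -/
noncomputable def agentFactor (q : ℝ) (x : TaskState C) (S : Matrix (Fin C) (Fin C) ℝ)
    (o : Option (Fin C)) : ℝ :=
  (if o ≠ none then q else 1 - q) * reportFactor x S o

theorem agentLaw_real_of_setBernoulli {ρ : ProbabilityMeasure (Set (Fin n))} {q : unitInterval}
    (hρ : (ρ : Measure (Set (Fin n))) = setBernoulli Set.univ q) (S : Strategy C)
    (a : Fin n → TaskState C) (r : Reports n C) :
    (agentLaw ρ S a).real (reportsOf ⁻¹' {r}) = ∏ t, agentFactor q (a t) S.1 (r t) := by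
  rw [agentLaw_real_preimage_reportsOf, hρ,
    setBernoulli_real_singleton _ (Set.subset_univ _) Set.finite_univ]
  simp only [agentFactor, Finset.prod_mul_distrib]
  congr 1
  rw [Finset.prod_ite, Finset.prod_const, Finset.prod_const, Set.ncard_eq_toFinset_card',
    Set.ncard_eq_toFinset_card']
  congr 2 <;>
  · congr 1
    ext t
    simp

/-- The probability of the list `v` of reports on a task in state `x`, given that agent `i`
performs the task exactly if `v i` is a report. -/
noncomputable def taskWeight (i : ι) (q : ι → unitInterval) (S : ι → Strategy C)
    (v : ι → Option (Fin C)) (x : TaskState C) : ℝ :=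
  (∏ j ∈ Finset.univ.erase i, agentFactor (q j) x (S j).1 (v j)) * reportFactor x (S i).1 (v i)

theorem agentFactor_nonneg (q : unitInterval) (x : TaskState C) (S : Strategy C)
    (o : Option (Fin C)) : 0 ≤ agentFactor q x S.1 o := by
  refine mul_nonneg ?_ (reportFactor_nonneg x S o)
  split_ifs
  · exact q.2.1
  · exact sub_nonneg.2 q.2.2

theorem continuous_prod_agentFactor (i : ι) (q : ι → unitInterval) (S : ι → Strategy C)
    (v : ι → Option (Fin C)) : Continuous fun x : TaskState C =>
      ∏ j ∈ Finset.univ.erase i, agentFactor (q j) x (S j).1 (v j) :=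
  continuous_finsetProd _ fun _ _ => continuous_const.mul (continuous_reportFactor _ _)

theorem continuous_taskWeight (i : ι) (q : ι → unitInterval) (S : ι → Strategy C)
    (v : ι → Option (Fin C)) : Continuous (taskWeight i q S v) :=
  (continuous_prod_agentFactor i q S v).mul (continuous_reportFactor _ _)

/-- Bernoulli assignment lets the laws of the other agents factor over tasks. The arbitrary law of
the set of `i` remains as one global factor, independent of her strategy. -/
theorem prod_agentLaw_real (i : ι) {q : ι → unitInterval}
    {ρ : ι → ProbabilityMeasure (Set (Fin n))}
    (hρ : ∀ j, j ≠ i → (ρ j : Measure (Set (Fin n))) = setBernoulli Set.univ (q j))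
    (S : ι → Strategy C) (a : Fin n → TaskState C) (r : ι → Reports n C) :
    ∏ j, (agentLaw (ρ j) (S j) a).real (reportsOf ⁻¹' {r j}) =
      (ρ i : Measure (Set (Fin n))).real {{t | r i t ≠ none}} *
        ∏ t, taskWeight i q S (fun j => r j t) (a t) := by
  rw [← Finset.prod_erase_mul _ _ (Finset.mem_univ i), agentLaw_real_preimage_reportsOf,
    Finset.prod_congr rfl fun j hj =>
      agentLaw_real_of_setBernoulli (hρ j (Finset.ne_of_mem_erase hj)) (S j) a (r j),
    Finset.prod_comm]
  simp only [taskWeight, Finset.prod_mul_distrib]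
  ring

theorem expectedPayment_eq_sum (ch : KDMIChoices n C) (μ : ProbabilityMeasure (TaskState C))
    (i : ι) {q : ι → unitInterval} {ρ : ι → ProbabilityMeasure (Set (Fin n))}
    (hρ : ∀ j, j ≠ i → (ρ j : Measure (Set (Fin n))) = setBernoulli Set.univ (q j))
    (S : ι → Strategy C) :
    expectedPayment ch μ ρ S i = ∑ T : Finset (Fin n),
      (ρ i : Measure (Set (Fin n))).real {(T : Set (Fin n))} *
        ∑ z : Fin n → ι → Option (Fin C),
          (∏ t, ∫ x, taskWeight i q S (z t) x ∂(μ : Measure (TaskState C))) *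
          (if performed (fun t => z t i) = T then payment ch (fun j t => z t j) i else 0) := by
  unfold expectedPayment
  simp only [expectedPaymentGiven_eq_sum, prod_agentLaw_real i hρ]
  have hcont : ∀ r : ι → Reports n C, Continuous fun a : Fin n → TaskState C =>
      (ρ i : Measure (Set (Fin n))).real {{t | r i t ≠ none}} *
        (∏ t, taskWeight i q S (fun j => r j t) (a t)) * payment ch r i := fun r =>
    (continuous_const.mul (continuous_finsetProd _ fun t _ =>
      (continuous_taskWeight i q S _).comp (continuous_apply t))).mul continuous_const
  rw [integral_finsetSum _ fun r _ => integrable_of_continuous_of_compactSpace (hcont r)]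
  simp only [Finset.mul_sum]
  -- Reports are regrouped by task instead of by agent, so that independence of the states turns the
  -- integral into a product over tasks.
  rw [Finset.sum_comm, ← Equiv.sum_comp (Equiv.piComm fun (_ : Fin n) (_ : ι) => Option (Fin C))]
  refine Finset.sum_congr rfl fun z _ => ?_
  rw [Finset.sum_eq_single (performed fun t => z t i), integral_mul_const, integral_const_mul]
  · have hint := integral_fintype_prod_eq_prod (𝕜 := ℝ)
      (μ := fun _ : Fin n => (μ : Measure (TaskState C))) fun t x => taskWeight i q S (z t) x
    rw [if_pos rfl, mul_assoc, ← hint]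
    have hset : ((performed fun t => z t i : Finset (Fin n)) : Set (Fin n)) =
        {t | z t i ≠ none} := by
      ext t
      simp [performed]
    rw [hset]
    rfl
  · intro T _ hT
    rw [if_neg fun h => hT h.symm, mul_zero, mul_zero]
  · simp

/-- For each state the weight is linear in the report law of `i`, and truthful reports have law `x`;
integration over the state preserves this linear relation, even though the state correlates all
reports. -/
theorem isGarbling_integral_taskWeight (μ : ProbabilityMeasure (TaskState C)) (i : ι)
    (q : ι → unitInterval) (S : ι → Strategy C) :
    IsGarbling i (S i) (fun v => ∫ x, taskWeight i q S v x ∂(μ : Measure (TaskState C)))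
      (fun v => ∫ x, taskWeight i q (Function.update S i 1) v x ∂(μ : Measure (TaskState C))) where
  nonneg v := integral_nonneg fun x => mul_nonneg
    (Finset.prod_nonneg fun j _ => agentFactor_nonneg _ _ _ _) (reportFactor_nonneg _ _ _)
  eq_of_none v hv := by
    have : taskWeight i q S v = taskWeight i q (Function.update S i 1) v := by
      funext x
      simp only [taskWeight, hv, reportFactor]
      congr 1
      exact Finset.prod_congr rfl fun j hj => by
        rw [Function.update_of_ne (Finset.ne_of_mem_erase hj)]
    rw [this]
  eq_of_some v c hv := by
    have hval : ∀ b x, taskWeight i q (Function.update S i 1) (Function.update v i (some b)) x =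
        (∏ j ∈ Finset.univ.erase i, agentFactor (q j) x (S j).1 (v j)) * x.1 b := by
      intro b x
      simp only [taskWeight, Function.update_self, reportFactor]
      congr 1
      · exact Finset.prod_congr rfl fun j hj => by
          rw [Function.update_of_ne (Finset.ne_of_mem_erase hj),
            Function.update_of_ne (Finset.ne_of_mem_erase hj)]
      · simp [reportProb, Matrix.one_apply]
    simp only [hval, ← integral_const_mul]
    refine Eq.trans ?_ (integral_finsetSum _ fun b _ => integrable_of_continuous_of_compactSpace
      (continuous_const.mul ((continuous_prod_agentFactor i q S v).mul
        ((continuous_apply b).comp continuous_subtype_val))))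
    refine integral_congr_ae (Eventually.of_forall fun x => ?_)
    simp only [taskWeight, hv, reportFactor, reportProb, Finset.mul_sum]
    exact Finset.sum_congr rfl fun b _ => by ring

theorem expectedPayment_le_update_one (ch : KDMIChoices n C)
    (μ : ProbabilityMeasure (TaskState C)) (i : ι) {q : ι → unitInterval}
    {ρ : ι → ProbabilityMeasure (Set (Fin n))}
    (hρ : ∀ j, j ≠ i → (ρ j : Measure (Set (Fin n))) = setBernoulli Set.univ (q j))
    (S : ι → Strategy C) :
    expectedPayment ch μ ρ S i ≤ expectedPayment ch μ ρ (Function.update S i 1) i := by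
  rw [expectedPayment_eq_sum ch μ i hρ, expectedPayment_eq_sum ch μ i hρ]
  exact Finset.sum_le_sum fun T _ => mul_le_mul_of_nonneg_left
    ((isGarbling_integral_taskWeight μ i q S).sum_payment_le ch T) measureReal_nonneg

end ExpectedPayment

theorem theorem2 (n C : ℕ) :
    -- Dominant truthfulness.
    (∀ (m : ℕ) (ch : KDMIChoices n C) (μ : ProbabilityMeasure (TaskState C))
      (ρ : Fin m → ProbabilityMeasure (Set (Fin n))) (i : Fin m),
      (∀ j, j ≠ i → ∃ p : unitInterval,
        (ρ j : Measure (Set (Fin n))) = setBernoulli Set.univ p) →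
      ∀ S : Fin m → Strategy C,
        (∀ a, Integrable (fun w => payment ch (fun j => reportsOf (w j)) i) (agentsLaw ρ S a)) ∧
        Integrable (expectedPaymentGiven ch ρ S i)
          (Measure.pi fun _ : Fin n => (μ : Measure (TaskState C))) ∧
        expectedPayment ch μ ρ S i ≤ expectedPayment ch μ ρ (Function.update S i 1) i) ∧
    -- Invariance of the extracted knowledge for infinitely many agents.
    (∀ (a : Fin n → TaskState C) (ρ : ℕ → ProbabilityMeasure (Set (Fin n))) (p : Fin n → ℝ),
      (∀ t, 0 < p t) →
      (∀ j t, (ρ j : Measure (Set (Fin n))).real {T | t ∈ T} = p t) →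
      ∀ (S : ℕ → Strategy C) (M : Matrix (Fin C) (Fin C) ℝ), HasLimitingStrategy S M →
        IsUnit M →
        (∀ᵐ w ∂(agentsLaw ρ S a),
          Tendsto (answersOfFirst w) atTop (𝓝 (stateMatrix a * M))) ∧
        SameDMIClusterings (stateMatrix a) (stateMatrix a * M) ∧
        ((stateMatrix a).rank = C → ∀ᵐ w ∂(agentsLaw ρ S a), ∀ᶠ m in atTop,
          DMIClusteringsRefine (answersOfFirst w m) (stateMatrix a))) ∧
    -- Reduction to the maximization of `det (Xᵀ A)` when `A` has rank `C`, and monotonicity.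
    (∀ A : Matrix (Fin n) (Fin C) ℝ, (∀ t c, 0 ≤ A t c) → (∀ t, ∑ c, A t c = 1) → A.rank = C →
      (addOnes A).rank = C ∧
      IsColumnChoice A C Sum.inl ∧ pickCols A Sum.inl = A ∧
      (∀ L : Fin C → Fin C ⊕ Unit, IsColumnChoice A C L →
        upToRelabeling (detMaximizers (pickCols A L)) = upToRelabeling (detMaximizers A)) ∧
      IsGreatest (detValues A) (dmiValue A) ∧
      ∀ M : Strategy C,
        IsGreatest (detValues (A * M.1)) (dmiValue (A * M.1)) ∧
        dmiValue (A * M.1) ≤ dmiValue A) ∧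
    -- The maximum value for infinitely many agents.
    (∀ (a : Fin n → TaskState C) (ρ : ℕ → ProbabilityMeasure (Set (Fin n))) (p : Fin n → ℝ),
      (∀ t, 0 < p t) →
      (∀ j t, (ρ j : Measure (Set (Fin n))).real {T | t ∈ T} = p t) →
      (stateMatrix a).rank = C →
      ∀ (S : ℕ → Strategy C) (M : Matrix (Fin C) (Fin C) ℝ), HasLimitingStrategy S M →
        (∀ᵐ w ∂(agentsLaw ρ S a),
          Tendsto (fun m => dmiValue (answersOfFirst w m)) atTop
            (𝓝 (dmiValue (stateMatrix a * M)))) ∧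
        dmiValue (stateMatrix a * M) ≤ dmiValue (stateMatrix a)) := by
  refine ⟨?_, ?_, ?_, ?_⟩
  · intro m ch μ ρ i hρ S
    refine ⟨fun a => ?_, integrable_of_continuous_of_compactSpace
      (continuous_expectedPaymentGiven ch ρ S i), ?_⟩
    · have : IsProbabilityMeasure (agentsLaw ρ S a) := by unfold agentsLaw; infer_instance
      exact Integrable.of_finite
    · have hq : ∀ j, ∃ q : unitInterval,
          j ≠ i → (ρ j : Measure (Set (Fin n))) = setBernoulli Set.univ q := fun j => by
        by_cases hj : j = i
        -- A dummy value: the set of agent `i` has an arbitrary law.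
        · exact ⟨0, fun h => absurd hj h⟩
        · obtain ⟨q, hq⟩ := hρ j hj
          exact ⟨q, fun _ => hq⟩
      choose q hq using hq
      exact expectedPayment_le_update_one ch μ i hq S
  · intro a ρ p hp hρ S M hS hM
    have hrow := sum_stateMatrix a
    have hrowM := sum_mul_rowStochastic hrow hS.mem_rowStochastic
    have hlim := ae_tendsto_answersOfFirst (a := a) hp hρ hS
    refine ⟨hlim, sameDMIClusterings_of_colSpan_eq ?_, fun hr => ?_⟩
    · rw [colSpan_addOnes hrow, colSpan_addOnes hrowM, colSpan_mul_of_isUnit hM]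
    · filter_upwards [hlim] with w hw
      exact eventually_dmiClusteringsRefine hrow hr hM hw (eventually_sum_answersOfFirst hw hrowM)
  · intro A _ hA hr
    have hcol := isColumnChoice_inl hA hr
    have hne := hardClusterings_nonempty hA
    exact ⟨hcol.1.symm, hcol, rfl,
      fun L hL => upToRelabeling_detMaximizers_pickCols hA hr hL, isGreatest_dmiValue A hne,
      fun M => ⟨isGreatest_dmiValue _ hne, dmiValue_mul_le A M.2⟩⟩
  · intro a ρ p hp hρ _ S M hS
    refine ⟨?_, dmiValue_mul_le _ hS.mem_rowStochastic⟩
    filter_upwards [ae_tendsto_answersOfFirst (a := a) hp hρ hS] with w hw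
    exact (continuous_dmiValue.tendsto _).comp hw
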